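/- Let $n,m,N$ be nonnegative integers, $\mathbf H\in\mathbb R^{m\times n}$, $\mathbf U=[\boldsymbol\mu_1\cdots\boldsymbol\mu_N]\in\mathbb R^{n\times N}$, let $\mathbf C_x\in\mathbb R^{n\times n}$ and $\mathbf C_w\in\mathbb R^{m\times m}$ be symmetric positive definite, and let $\nu_x>n+1$, $\nu_w>m+1$ be real. Consider $\mathbf Y=\mathbf H\mathbf X+\mathbf W$ with $\mathbf X=[\mathbf x_1\cdots\mathbf x_N]\in\mathbb R^{n\times N}$ and $\mathbf W=[\mathbf w_1\cdots\mathbf w_N]\in\mathbb R^{m\times N}$. The covariance matrices $\mathbf P$ and $\mathbf R$ are independent with inverse-Wishart distributions $\mathcal W^{-1}(\mathbf C_x,\nu_x)$ and $\mathcal W^{-1}(\mathbf C_w,\nu_w)$, where $\mathcal W^{-1}(\mathbf C,\nu)$ on $k\times k$ positive definite matrices has density proportional to $|\mathbf P|^{-(\nu+k+1)/2}e^{-\frac12\mathrm{tr}(\mathbf C\mathbf P^{-1})}$ with respect to $\prod_{i\le j}dP_{ij}$. Given $(\mathbf P,\mathbf R)$, all columns $\mathbf x_t\sim\mathcal N(\boldsymbol\mu_t,\mathbf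 P)$ and $\mathbf w_t\sim\mathcal N(\mathbf 0,\mathbf R)$ are independent; the law of $(\mathbf X,\mathbf W)$ is thus specified by $p(\mathbf X|\mathbf P)$ and $p(\mathbf W|\mathbf R)$. Let $p(\mathbf X,\mathbf Y,\mathbf P,\mathbf R)=p(\mathbf Y|\mathbf X,\mathbf R)\,p(\mathbf X|\mathbf P)\,p(\mathbf P)\,p(\mathbf R)$ be the joint density, from which the densities $p(\mathbf X,\mathbf Y)$, $p(\mathbf X)$, $p(\mathbf Y)$, $p(\mathbf Y|\mathbf X)=p(\mathbf X,\mathbf Y)/p(\mathbf X)$ and $p(\mathbf X|\mathbf Y)=p(\mathbf X,\mathbf Y)/p(\mathbf Y)$ are formed. Write $\widetilde{\mathbf X}=\mathbf X-\mathbf U$ and $\widetilde{\mathbf Y}=\mathbf Y-\mathbf H\mathbf X$. Then: 1. For all $\mathbf X$, with a proportionality constant in $(0,\infty)$ that does not depend on $\mathbf X$, $$p(\mathbf X)=\int_{\mathbf P\succ\mathbf 0}p(\mathbf X|\mathbf P)\,p(\mathbf P)\,d\mathbf P\;\propto\;\bigl|\widetilde{\mathbf X}\widetilde{\mathbf X}^\top+\mathbf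 C_x\bigr|^{-(\nu_x+N)/2}.$$ 2. For all $\mathbf X,\mathbf Y$, with a proportionality constant in $(0,\infty)$ that depends on neither $\mathbf X$ nor $\mathbf Y$, $$p(\mathbf Y|\mathbf X)=\int_{\mathbf R\succ\mathbf 0}p(\mathbf Y|\mathbf X,\mathbf R)\,p(\mathbf R)\,d\mathbf R\;\propto\;\bigl|\widetilde{\mathbf Y}\widetilde{\mathbf Y}^\top+\mathbf C_w\bigr|^{-(\nu_w+N)/2}.$$ 3. For every $\mathbf Y$, as functions of $\mathbf X$, $p(\mathbf X|\mathbf Y)\propto p(\mathbf Y|\mathbf X)\,p(\mathbf X)$ with a constant in $(0,\infty)$, $p(\mathbf X|\mathbf Y)$ is positive and finite, and $-\ln p(\mathbf X|\mathbf Y)=V'(\mathbf X)+K$ with $K\in\mathbb R$ not depending on $\mathbf X$, where $$V'(\mathbf X)=\frac{\gamma'_w}{2}\ln\bigl|\mathbf I_N+(\mathbf Y-\mathbf H\mathbf X)^\top\mathbf C_w^{-1}(\mathbf Y-\mathbf H\mathbf X)\bigr|+\frac{\gamma'_x}{2}\ln\bigl|\mathbf I_N+(\mathbf X-\mathbf U)^\top\mathbf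 C_x^{-1}(\mathbf X-\mathbf U)\bigr|,\qquad \gamma'_w=\nu_w+N,\quad\gamma'_x=\nu_x+N.$$ A marginalized MAP estimate, i.e. a maximizer $\widehat{\mathbf X}_{\mathrm{mmap}}$ of $p(\mathbf X|\mathbf Y)$ over $\mathbf X\in\mathbb R^{n\times N}$, exists, and a matrix is a marginalized MAP estimate if and only if it minimizes $V'$ over $\mathbb R^{n\times N}$. -/

import Mathlib

open MeasureTheory
open scoped ENNReal

namespace MMAP

/-- The free coordinates `(i, j)`, `i ≤ j`, of a symmetric `k × k` matrix. -/
abbrev SymIdx (k : ℕ) : Type := {p : Fin k × Fin k // p.1 ≤ p.2}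

/-- The symmetric matrix with prescribed entries on and above the diagonal. -/
def symMatrix {k : ℕ} (v : SymIdx k → ℝ) : Matrix (Fin k) (Fin k) ℝ :=
  Matrix.of fun i j => v ⟨(min i j, max i j), min_le_max⟩

/-- `∫_{P ≻ 0} f(P) dP`, the integral over the cone of positive definite matrices with respect to
the Lebesgue measure `dP = ∏_{i ≤ j} dP_{ij}` on symmetric matrices. -/
noncomputable def integralPosDef {k : ℕ} (f : Matrix (Fin k) (Fin k) ℝ → ℝ≥0∞) : ℝ≥0∞ :=
  ∫⁻ v in {v : SymIdx k → ℝ | (symMatrix v).PosDef}, f (symMatrix v)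

/-- `∫ f(X) dX` over all `a × b` matrices, `dX = ∏_{i,t} dX_{it}`. -/
noncomputable def integralMatrix {a b : ℕ} (f : Matrix (Fin a) (Fin b) ℝ → ℝ≥0∞) : ℝ≥0∞ :=
  ∫⁻ X : Fin a → Fin b → ℝ, f (Matrix.of X)

/-- The density at `x` of the Gaussian distribution `N(μ, S)`, for positive definite `S`. -/
noncomputable def gaussianDensity {k : ℕ} (μ : Fin k → ℝ) (S : Matrix (Fin k) (Fin k) ℝ)
    (x : Fin k → ℝ) : ℝ :=
  (Real.sqrt ((2 * Real.pi) ^ k * S.det))⁻¹ *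
    Real.exp (-(1 / 2) * dotProduct (x - μ) (Matrix.mulVec S⁻¹ (x - μ)))

/-- The density at `Z = [z_1 ⋯ z_N]` of a matrix whose columns are independent, the `t`-th one
being `N(M_t, S)`-distributed, where `M_t` is the `t`-th column of `M`. -/
noncomputable def gaussianColumnsDensity {k N : ℕ} (M : Matrix (Fin k) (Fin N) ℝ)
    (S : Matrix (Fin k) (Fin k) ℝ) (Z : Matrix (Fin k) (Fin N) ℝ) : ℝ≥0∞ :=
  ENNReal.ofReal (∏ t : Fin N, gaussianDensity (fun i => M i t) S (fun i => Z i t))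

/-- The unnormalized inverse-Wishart density `|P|^{-(ν+k+1)/2} exp(-tr(C P⁻¹)/2)`, `P ≻ 0`. -/
noncomputable def invWishartKernel {k : ℕ} (C : Matrix (Fin k) (Fin k) ℝ) (ν : ℝ)
    (P : Matrix (Fin k) (Fin k) ℝ) : ℝ≥0∞ :=
  ENNReal.ofReal (P.det ^ (-(ν + k + 1) / 2) * Real.exp (-(1 / 2) * (C * P⁻¹).trace))

/-- The density at `P ≻ 0` of the inverse-Wishart distribution `W⁻¹(C, ν)`: the kernel divided
by its integral over the positive definite cone. -/
noncomputable def invWishartDensity {k : ℕ} (C : Matrix (Fin k) (Fin k) ℝ) (ν : ℝ)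
    (P : Matrix (Fin k) (Fin k) ℝ) : ℝ≥0∞ :=
  invWishartKernel C ν P / integralPosDef (invWishartKernel C ν)

/-- The known quantities of the hierarchical linear Gaussian model
`Y = H X + W`, `x_t | P ~ N(u_t, P)`, `w_t | R ~ N(0, R)`,
`P ~ W⁻¹(Cx, νx)`, `R ~ W⁻¹(Cw, νw)`, with `P` and `R` independent. -/
structure Model (n m N : ℕ) where
  H : Matrix (Fin m) (Fin n) ℝ
  U : Matrix (Fin n) (Fin N) ℝ
  Cx : Matrix (Fin n) (Fin n) ℝ
  Cw : Matrix (Fin m) (Fin m) ℝ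
  νx : ℝ
  νw : ℝ

namespace Model

variable {n m N : ℕ} (M : Model n m N)

/-- `p(P)`. -/
noncomputable def pP (P : Matrix (Fin n) (Fin n) ℝ) : ℝ≥0∞ :=
  invWishartDensity M.Cx M.νx P

/-- `p(R)`. -/
noncomputable def pR (R : Matrix (Fin m) (Fin m) ℝ) : ℝ≥0∞ :=
  invWishartDensity M.Cw M.νw R

/-- `p(X | P)`. -/
noncomputable def pXgivenP (X : Matrix (Fin n) (Fin N) ℝ) (P : Matrix (Fin n) (Fin n) ℝ) :
    ℝ≥0∞ :=
  gaussianColumnsDensity M.U P X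

/-- `p(Y | X, R)`: the density of the noise `W` given `R`, evaluated at `Y - H X`. -/
noncomputable def pYgivenXR (Y : Matrix (Fin m) (Fin N) ℝ) (X : Matrix (Fin n) (Fin N) ℝ)
    (R : Matrix (Fin m) (Fin m) ℝ) : ℝ≥0∞ :=
  gaussianColumnsDensity 0 R (Y - M.H * X)

/-- The joint density `p(X, Y, P, R)`. -/
noncomputable def pXYPR (X : Matrix (Fin n) (Fin N) ℝ) (Y : Matrix (Fin m) (Fin N) ℝ)
    (P : Matrix (Fin n) (Fin n) ℝ) (R : Matrix (Fin m) (Fin m) ℝ) : ℝ≥0∞ :=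
  M.pYgivenXR Y X R * M.pXgivenP X P * M.pP P * M.pR R

/-- `p(X, Y)`: the covariance matrices are integrated out. -/
noncomputable def pXY (X : Matrix (Fin n) (Fin N) ℝ) (Y : Matrix (Fin m) (Fin N) ℝ) : ℝ≥0∞ :=
  integralPosDef fun P => integralPosDef fun R => M.pXYPR X Y P R

/-- The marginal density `p(X)`. -/
noncomputable def pX (X : Matrix (Fin n) (Fin N) ℝ) : ℝ≥0∞ :=
  integralMatrix fun Y => M.pXY X Y

/-- The marginal density `p(Y)`. -/
noncomputable def pY (Y : Matrix (Fin m) (Fin N) ℝ) : ℝ≥0∞ :=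
  integralMatrix fun X => M.pXY X Y

/-- The conditional density `p(Y | X)`. -/
noncomputable def pYgivenX (Y : Matrix (Fin m) (Fin N) ℝ) (X : Matrix (Fin n) (Fin N) ℝ) :
    ℝ≥0∞ :=
  M.pXY X Y / M.pX X

/-- The marginalized posterior density `p(X | Y)`. -/
noncomputable def pXgivenY (X : Matrix (Fin n) (Fin N) ℝ) (Y : Matrix (Fin m) (Fin N) ℝ) :
    ℝ≥0∞ :=
  M.pXY X Y / M.pY Y

/-- `X̂` is a marginalized MAP estimate for the observation `Y`: it maximizes `p(X | Y)`. -/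
def IsMarginalizedMAP (Y : Matrix (Fin m) (Fin N) ℝ) (Xhat : Matrix (Fin n) (Fin N) ℝ) : Prop :=
  IsMaxOn (fun X => M.pXgivenY X Y) Set.univ Xhat

/-- The cost function with weights `γw` and `γx`,
`γw/2 ln|I + (Y-HX)ᵀ Cw⁻¹ (Y-HX)| + γx/2 ln|I + (X-U)ᵀ Cx⁻¹ (X-U)|`. -/
noncomputable def cost (γw γx : ℝ) (Y : Matrix (Fin m) (Fin N) ℝ)
    (X : Matrix (Fin n) (Fin N) ℝ) : ℝ :=
  γw / 2 * Real.log (1 + (Y - M.H * X).transpose * M.Cw⁻¹ * (Y - M.H * X)).det +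
    γx / 2 * Real.log (1 + (X - M.U).transpose * M.Cx⁻¹ * (X - M.U)).det

end Model

end MMAP

/-! The engine is conjugacy. The quadratic forms of the Gaussian columns sum to `tr((Z - M)(Z - M)ᵀ
P⁻¹)`, so the Gaussian density times the kernel of `W⁻¹(C, ν)` is a constant times the kernel of
`W⁻¹((Z - M)(Z - M)ᵀ + C, ν + N)` (`gaussianColumnsDensity_mul_invWishartKernel`). Integrating over
the cone with the scaling law `∫ kernel(C, ν) = |C|^(-ν/2) ∫ kernel(1, ν)`
(`integralPosDef_invWishartKernel`) gives the power of the determinant, in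
`exists_columnsMarginal_eq`.

The scaling law is the substitution `P = A Q Aᵀ` with `C = A Aᵀ`, whose Jacobian on symmetric
matrices is `|det A|^(k+1)`. Taking `A = O D`, the diagonal factor acts diagonally on coordinates
and is computed directly. For orthogonal `O` the substitution fixes the integral of the kernel with
`C = 1`, which is finite and nonzero, so its Jacobian is `1` in absolute value. Finiteness for `ν >
k - 1` is an induction on `k`: with one row and column split off, the off-diagonal vector integrates
as a Gaussian, the Schur complement as an inverse gamma variable, and the kernel of size `k` with `ν
- 1` remains.

The joint density then factors as `p(X, Y) = p(Y | X) p(X)` with both factors explicit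
(`Model.pXY_eq`). Each integrates to one by Tonelli; `p(Y)` is finite because the likelihood is
bounded uniformly in `X`. Sylvester's identity `|Z Zᵀ + C| = |C| |1 + Zᵀ C⁻¹ Z|` turns `-ln p(X |
Y)` into the cost plus a constant, so maximizers and minimizers agree. One exists because the cost
is continuous and coercive, by `det (1 + A) ≥ 1 + tr A` for `A ⪰ 0`. -/

namespace MMAP

/-! ### Coordinates on symmetric matrices and the positive definite cone -/

section SymmetricCoordinates

variable {k : ℕ}

lemma symMatrix_apply (v : SymIdx k → ℝ) {i j : Fin k} (h : i ≤ j) :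
    symMatrix v i j = v ⟨(i, j), h⟩ := by
  simp [symMatrix, min_eq_left h, max_eq_right h]

lemma symMatrix_transpose (v : SymIdx k → ℝ) : (symMatrix v).transpose = symMatrix v := by
  ext i j
  simp [symMatrix, min_comm, max_comm]

/-- The entries on and above the diagonal of a matrix. -/
def symCoords (P : Matrix (Fin k) (Fin k) ℝ) : SymIdx k → ℝ := fun p => P p.1.1 p.1.2

lemma symCoords_symMatrix (v : SymIdx k → ℝ) : symCoords (symMatrix v) = v := by
  funext p
  exact symMatrix_apply v p.2

lemma symMatrix_symCoords {P : Matrix (Fin k) (Fin k) ℝ} (hP : P.transpose = P) :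
    symMatrix (symCoords P) = P := by
  ext i j
  rcases le_total i j with h | h
  · rw [symMatrix_apply _ h]; rfl
  · rw [← symMatrix_transpose, Matrix.transpose_apply, symMatrix_apply _ h]
    exact congrFun (congrFun hP i) j

lemma continuous_symMatrix :
    Continuous (symMatrix : (SymIdx k → ℝ) → Matrix (Fin k) (Fin k) ℝ) :=
  continuous_matrix fun _ _ => continuous_apply _

lemma symMatrix_add (v w : SymIdx k → ℝ) : symMatrix (v + w) = symMatrix v + symMatrix w := rfl

lemma symMatrix_smul (c : ℝ) (v : SymIdx k → ℝ) : symMatrix (c • v) = c • symMatrix v := rfl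

/-- The set of coordinates of positive definite matrices. -/
def posDefCone (k : ℕ) : Set (SymIdx k → ℝ) := {v | (symMatrix v).PosDef}

lemma symMatrix_isHermitian (v : SymIdx k → ℝ) : (symMatrix v).IsHermitian := by
  rw [Matrix.IsHermitian, Matrix.conjTranspose_eq_transpose_of_trivial, symMatrix_transpose]

/-- Positive definite means positive semidefinite, a closed condition, with nonzero determinant, an
open one. -/
lemma measurableSet_posDefCone : MeasurableSet (posDefCone k) := by
  have : posDefCone k = {v | ∀ x : Fin k → ℝ, 0 ≤ dotProduct (star x) ((symMatrix v).mulVec x)} ∩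
      {v | (symMatrix v).det ≠ 0} := by
    ext v
    constructor
    · intro h
      exact ⟨fun x => h.posSemidef.dotProduct_mulVec_nonneg x, h.det_pos.ne'⟩
    · rintro ⟨h1, h2⟩
      exact (Matrix.PosSemidef.of_dotProduct_mulVec_nonneg
        (symMatrix_isHermitian v) h1).posDef_iff_det_ne_zero.2 h2
  rw [this]
  refine MeasurableSet.inter (IsClosed.measurableSet ?_) (IsOpen.measurableSet ?_)
  · rw [Set.ofPred_forall]
    refine isClosed_iInter fun x => isClosed_le continuous_const ?_
    exact continuous_const.dotProduct (continuous_symMatrix.matrix_mulVec continuous_const)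
  · exact isOpen_ne_fun continuous_symMatrix.matrix_det continuous_const

/-- The cone contains a neighbourhood of the identity: by compactness of the unit sphere, positivity
of the quadratic form there persists under small perturbations, and homogeneity extends it to all
nonzero vectors. This keeps inverse-Wishart normalizers away from zero. -/
lemma volume_posDefCone_ne_zero : volume (posDefCone k) ≠ 0 := by
  have hK : IsCompact (Metric.sphere (0 : EuclideanSpace ℝ (Fin k)) 1) := isCompact_sphere _ _
  have hone : symMatrix (symCoords (1 : Matrix (Fin k) (Fin k) ℝ)) = 1 :=
    symMatrix_symCoords (by simp)
  have hev : ∀ᶠ v in nhds (symCoords (1 : Matrix (Fin k) (Fin k) ℝ)),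
      ∀ x ∈ Metric.sphere (0 : EuclideanSpace ℝ (Fin k)) 1,
        0 < dotProduct x.ofLp ((symMatrix v).mulVec x.ofLp) := by
    refine hK.eventually_forall_of_forall_eventually fun x hx => ?_
    refine IsOpen.mem_nhds (isOpen_lt continuous_const ?_) ?_
    · refine Continuous.dotProduct (by fun_prop) (Continuous.matrix_mulVec ?_ (by fun_prop))
      exact continuous_symMatrix.comp continuous_fst
    · have hx0 : x.ofLp ≠ 0 := by
        intro h
        have : x = 0 := by ext i; exact congrFun h i
        simp [this] at hx
      have := (Matrix.PosDef.one (n := Fin k) (R := ℝ)).dotProduct_mulVec_pos hx0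
      simpa [hone] using this
  refine (Measure.measure_pos_of_mem_nhds volume (x := symCoords 1) ?_).ne'
  filter_upwards [hev] with v hv
  refine Matrix.PosDef.of_dotProduct_mulVec_pos (symMatrix_isHermitian v) fun x hx => ?_
  set y : EuclideanSpace ℝ (Fin k) := WithLp.toLp 2 x
  have hy : y ≠ 0 := by
    intro h
    exact hx (by simpa [y] using h)
  have hyn : 0 < ‖y‖ := norm_pos_iff.2 hy
  have h1 := hv (‖y‖⁻¹ • y) (by simp [norm_smul, hyn.ne'])
  have h2 : dotProduct (‖y‖⁻¹ • y).ofLp ((symMatrix v).mulVec (‖y‖⁻¹ • y).ofLp) =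
      ‖y‖⁻¹ * (‖y‖⁻¹ * dotProduct x ((symMatrix v).mulVec x)) := by
    simp [y, Matrix.mulVec_smul]
  rw [h2] at h1
  have hi : 0 < ‖y‖⁻¹ := inv_pos.2 hyn
  simpa using pos_of_mul_pos_right (pos_of_mul_pos_right h1 hi.le) hi.le

lemma integralPosDef_eq_lintegral_indicator (f : Matrix (Fin k) (Fin k) ℝ → ℝ≥0∞) :
    integralPosDef f = ∫⁻ v, (posDefCone k).indicator (fun v => f (symMatrix v)) v :=
  (lintegral_indicator measurableSet_posDefCone _).symm

lemma integralPosDef_congr {f g : Matrix (Fin k) (Fin k) ℝ → ℝ≥0∞}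
    (h : ∀ P, P.PosDef → f P = g P) : integralPosDef f = integralPosDef g :=
  setLIntegral_congr_fun measurableSet_posDefCone fun _ hv => h _ hv

lemma integralPosDef_const_mul {c : ℝ≥0∞} (hc : c ≠ ∞) (f : Matrix (Fin k) (Fin k) ℝ → ℝ≥0∞) :
    integralPosDef (fun P => c * f P) = c * integralPosDef f :=
  lintegral_const_mul' _ _ hc

lemma measurable_symMatrix_inv_apply (i j : Fin k) :
    Measurable fun v : SymIdx k → ℝ => (symMatrix v)⁻¹ i j := by
  simp only [Matrix.inv_def, Ring.inverse_eq_inv', Matrix.smul_apply, smul_eq_mul]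
  exact continuous_symMatrix.matrix_det.measurable.inv.mul
    (continuous_symMatrix.matrix_adjugate.matrix_elem i j).measurable

end SymmetricCoordinates

/-! ### Congruences and their Jacobians -/

section Congruence

variable {k : ℕ}

/-- The congruence `P ↦ A P Aᵀ`, in the coordinates of symmetric matrices. -/
def congruence (A : Matrix (Fin k) (Fin k) ℝ) : (SymIdx k → ℝ) →ₗ[ℝ] (SymIdx k → ℝ) where
  toFun v := symCoords (A * symMatrix v * A.transpose)
  map_add' v w := by
    simp only [symMatrix_add, mul_add, add_mul]
    rfl
  map_smul' c v := by
    simp only [symMatrix_smul, Matrix.mul_smul, Matrix.smul_mul]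
    rfl

lemma symMatrix_congruence (A : Matrix (Fin k) (Fin k) ℝ) (v : SymIdx k → ℝ) :
    symMatrix (congruence A v) = A * symMatrix v * A.transpose := by
  refine symMatrix_symCoords (P := A * symMatrix v * A.transpose) ?_
  simp [Matrix.transpose_mul, symMatrix_transpose, Matrix.mul_assoc]

lemma congruence_mul (A B : Matrix (Fin k) (Fin k) ℝ) :
    congruence (A * B) = congruence A ∘ₗ congruence B := by
  ext1 v
  refine LinearMap.ext fun w => ?_
  rw [← symCoords_symMatrix ((congruence (A * B) ∘ₗ _) w),
    ← symCoords_symMatrix (((congruence A ∘ₗ congruence B) ∘ₗ _) w)]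
  simp [symMatrix_congruence, Matrix.transpose_mul, Matrix.mul_assoc]

lemma congruence_one : congruence (1 : Matrix (Fin k) (Fin k) ℝ) = LinearMap.id := by
  refine LinearMap.ext fun w => ?_
  rw [← symCoords_symMatrix (congruence 1 w)]
  simp [symMatrix_congruence, symCoords_symMatrix]

lemma det_congruence_mul (A B : Matrix (Fin k) (Fin k) ℝ) :
    LinearMap.det (congruence (A * B)) =
      LinearMap.det (congruence A) * LinearMap.det (congruence B) := by
  rw [congruence_mul, LinearMap.det_comp]

lemma det_congruence_ne_zero {A : Matrix (Fin k) (Fin k) ℝ} (hA : IsUnit A) :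
    LinearMap.det (congruence A) ≠ 0 := by
  obtain ⟨B, hB⟩ := hA.exists_right_inv
  have h := det_congruence_mul A B
  rw [hB, congruence_one, LinearMap.det_id] at h
  exact left_ne_zero_of_mul_eq_one h.symm

lemma congruence_mem_posDefCone_iff {A : Matrix (Fin k) (Fin k) ℝ} (hA : IsUnit A)
    (v : SymIdx k → ℝ) : congruence A v ∈ posDefCone k ↔ v ∈ posDefCone k := by
  have := Matrix.IsUnit.posDef_star_right_conjugate_iff (x := symMatrix v) hA
  rwa [Matrix.star_eq_conjTranspose, Matrix.conjTranspose_eq_transpose_of_trivial,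
    ← symMatrix_congruence] at this

/-- An invertible linear map is a measurable equivalence, so the change of variables holds for
arbitrary `f`. -/
lemma lintegral_comp_linearMap {E : Type*} [NormedAddCommGroup E] [NormedSpace ℝ E]
    [MeasurableSpace E] [BorelSpace E] [FiniteDimensional ℝ E] (μ : Measure E)
    [μ.IsAddHaarMeasure] {L : E →ₗ[ℝ] E} (hL : LinearMap.det L ≠ 0) (f : E → ℝ≥0∞) :
    ENNReal.ofReal |LinearMap.det L| * ∫⁻ x, f (L x) ∂μ = ∫⁻ x, f x ∂μ := by
  let e : E ≃L[ℝ] E := (LinearEquiv.ofIsUnitDet (f := L) (v := Module.finBasis ℝ E)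
    (v' := Module.finBasis ℝ E) (by simpa using hL)).toContinuousLinearEquiv
  have he : ∀ x, e.toHomeomorph.toMeasurableEquiv x = L x := fun x => rfl
  have hmap := Measure.map_linearMap_addHaar_eq_smul_addHaar μ hL
  have h := lintegral_map_equiv (μ := μ) f e.toHomeomorph.toMeasurableEquiv
  simp only [he] at h
  rw [← h]
  have : (⇑e.toHomeomorph.toMeasurableEquiv : E → E) = L := funext he
  rw [this, hmap, lintegral_smul_measure, smul_eq_mul, ← mul_assoc,
    ← ENNReal.ofReal_mul (abs_nonneg _), ← abs_mul, mul_inv_cancel₀ hL]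
  simp

lemma integralPosDef_congruence {A : Matrix (Fin k) (Fin k) ℝ} (hA : IsUnit A)
    (f : Matrix (Fin k) (Fin k) ℝ → ℝ≥0∞) :
    ENNReal.ofReal |LinearMap.det (congruence A)| *
      integralPosDef (fun P => f (A * P * A.transpose)) = integralPosDef f := by
  rw [integralPosDef_eq_lintegral_indicator, integralPosDef_eq_lintegral_indicator,
    ← lintegral_comp_linearMap volume (det_congruence_ne_zero hA)
      ((posDefCone k).indicator fun v => f (symMatrix v))]
  congr 2
  funext v
  by_cases hv : v ∈ posDefCone k
  · rw [Set.indicator_of_mem hv, Set.indicator_of_mem ((congruence_mem_posDefCone_iff hA v).2 hv),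
      symMatrix_congruence]
  · rw [Set.indicator_of_notMem hv,
      Set.indicator_of_notMem (mt (congruence_mem_posDefCone_iff hA v).1 hv)]

/-- The factor `d i` occurs once for each `j ≥ i` and once for each `j ≤ i`, hence `(k - i) + (i +
1) = k + 1` times; the diagonal pair counts twice. -/
lemma prod_symIdx_mul (d : Fin k → ℝ) :
    ∏ p : SymIdx k, d p.1.1 * d p.1.2 = (∏ i, d i) ^ (k + 1) := by
  have h1 : ∏ p : SymIdx k, d p.1.1 * d p.1.2 =
      ∏ p ∈ Finset.univ.filter (fun p : Fin k × Fin k => p.1 ≤ p.2), d p.1 * d p.2 :=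
    (Finset.prod_subtype _ (fun _ => by simp) (fun p : Fin k × Fin k => d p.1 * d p.2)).symm
  rw [h1, Finset.prod_filter, ← Finset.univ_product_univ]
  have h2 : ∀ p : Fin k × Fin k, (if p.1 ≤ p.2 then d p.1 * d p.2 else 1) =
      (if p.1 ≤ p.2 then d p.1 else 1) * (if p.1 ≤ p.2 then d p.2 else 1) := by
    intro p; split_ifs <;> simp
  simp only [h2, Finset.prod_mul_distrib]
  rw [Finset.prod_product, Finset.prod_product_right, ← Finset.prod_mul_distrib,
    ← Finset.prod_pow]
  refine Finset.prod_congr rfl fun i _ => ?_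
  dsimp only
  rw [← Finset.prod_filter, ← Finset.prod_filter, Finset.prod_const, Finset.prod_const, ← pow_add]
  congr 1
  have h3 : Finset.univ.filter (fun j => i ≤ j) = Finset.Ici i := by ext; simp
  have h4 : Finset.univ.filter (fun j => j ≤ i) = Finset.Iic i := by ext; simp
  rw [h3, h4, Fin.card_Ici, Fin.card_Iic]
  omega

lemma det_congruence_diagonal (d : Fin k → ℝ) :
    LinearMap.det (congruence (Matrix.diagonal d)) = (∏ i, d i) ^ (k + 1) := by
  have : congruence (Matrix.diagonal d) =
      Matrix.toLin' (Matrix.diagonal fun p : SymIdx k => d p.1.1 * d p.1.2) := by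
    refine LinearMap.ext fun v => funext fun p => ?_
    have : congruence (Matrix.diagonal d) v p =
      (Matrix.diagonal d * symMatrix v * (Matrix.diagonal d).transpose) p.1.1 p.1.2 := rfl
    rw [this, Matrix.diagonal_transpose, Matrix.mul_diagonal, Matrix.diagonal_mul,
      symMatrix_apply v p.2, Matrix.toLin'_apply, Matrix.mulVec_diagonal]
    ring
  rw [this, LinearMap.det_toLin', Matrix.det_diagonal, prod_symIdx_mul]

end Congruence

/-! ### Factorizations of positive definite matrices -/

section Factorization

variable {k : ℕ}

lemma exists_orthogonal_diagonalization {C : Matrix (Fin k) (Fin k) ℝ} (hC : C.PosDef) :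
    ∃ (O : Matrix (Fin k) (Fin k) ℝ) (d : Fin k → ℝ), O * O.transpose = 1 ∧ (∀ i, 0 < d i) ∧
      C = O * Matrix.diagonal d * O.transpose := by
  refine ⟨hC.1.eigenvectorUnitary, hC.1.eigenvalues, ?_, hC.eigenvalues_pos, ?_⟩
  · rw [← Matrix.conjTranspose_eq_transpose_of_trivial, ← Matrix.star_eq_conjTranspose]
    exact Unitary.coe_mul_star_self _
  · rw [← Matrix.conjTranspose_eq_transpose_of_trivial, ← Matrix.star_eq_conjTranspose]
    exact hC.1.spectral_theorem

/-- The orthogonal and diagonal factors stay separate because the Jacobian of the congruence is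
found for each in a different way. -/
lemma exists_orthogonal_mul_diagonal {C : Matrix (Fin k) (Fin k) ℝ} (hC : C.PosDef) :
    ∃ (O : Matrix (Fin k) (Fin k) ℝ) (d : Fin k → ℝ), O * O.transpose = 1 ∧ (∀ i, 0 < d i) ∧
      C = (O * Matrix.diagonal d) * (O * Matrix.diagonal d).transpose := by
  obtain ⟨O, d, hO, hd, h⟩ := exists_orthogonal_diagonalization hC
  refine ⟨O, fun i => √(d i), hO, fun i => Real.sqrt_pos.2 (hd i), ?_⟩
  rw [Matrix.transpose_mul, Matrix.diagonal_transpose, Matrix.mul_assoc,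
    ← Matrix.mul_assoc (Matrix.diagonal _), Matrix.diagonal_mul_diagonal]
  simp only [Real.mul_self_sqrt (hd _).le]
  rw [h, Matrix.mul_assoc]

lemma exists_mul_transpose_eq {C : Matrix (Fin k) (Fin k) ℝ} (hC : C.PosDef) :
    ∃ A : Matrix (Fin k) (Fin k) ℝ, IsUnit A ∧ C = A * A.transpose := by
  obtain ⟨O, d, -, -, h⟩ := exists_orthogonal_mul_diagonal hC
  refine ⟨_, ?_, h⟩
  have hu := hC.isUnit
  rw [h, Matrix.isUnit_iff_isUnit_det, Matrix.det_mul] at hu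
  rw [Matrix.isUnit_iff_isUnit_det]
  exact isUnit_of_mul_isUnit_left hu

end Factorization

/-! ### Normalization of Gaussian densities -/

section Gaussian

variable {k N : ℕ}

lemma gaussianDensity_nonneg (μ : Fin k → ℝ) (S : Matrix (Fin k) (Fin k) ℝ) (x : Fin k → ℝ) :
    0 ≤ gaussianDensity μ S x := by
  unfold gaussianDensity; positivity

lemma continuous_gaussianDensity (μ : Fin k → ℝ) (S : Matrix (Fin k) (Fin k) ℝ) :
    Continuous (gaussianDensity μ S) := by
  unfold gaussianDensity
  refine continuous_const.mul (Real.continuous_exp.comp (continuous_const.mul ?_))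
  exact Continuous.dotProduct (by fun_prop) (Continuous.matrix_mulVec continuous_const (by fun_prop))

lemma lintegral_prod_ofReal {ι : Type*} [Fintype ι] {E : Type*} [MeasureSpace E]
    [SigmaFinite (volume : Measure E)] (f : ι → E → ℝ) (hm : ∀ i, AEStronglyMeasurable (f i))
    (h0 : ∀ i x, 0 ≤ f i x) (h1 : ∀ i, ∫⁻ x, ENNReal.ofReal (f i x) = 1) :
    ∫⁻ x : ι → E, ENNReal.ofReal (∏ i, f i (x i)) = 1 := by
  have hint : ∀ i, Integrable (f i) := fun i =>
    (lintegral_ofReal_ne_top_iff_integrable (hm i) (Filter.Eventually.of_forall (h0 i))).1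
      (by simp [h1])
  have hprod : Integrable fun x : ι → E => ∏ i, f i (x i) := Integrable.fintype_prod hint
  rw [← ofReal_integral_eq_lintegral_ofReal hprod
    (Filter.Eventually.of_forall fun x => Finset.prod_nonneg fun i _ => h0 i _),
    integral_fintype_prod_volume_eq_prod]
  have : ∀ i, ∫ x, f i x = 1 := fun i => by
    rw [integral_eq_lintegral_of_nonneg_ae (Filter.Eventually.of_forall (h0 i)) (hm i), h1]
    simp
  simp [this]

/-- Whitening: in the variable `z` the quadratic form becomes `∑ z i ^ 2` and the density splits
into standard normals. -/
lemma gaussianDensity_mulVec (μ z : Fin k → ℝ) {A : Matrix (Fin k) (Fin k) ℝ} (hA : IsUnit A) :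
    gaussianDensity μ (A * A.transpose) (A.mulVec z + μ) =
      |A.det|⁻¹ * ∏ i, ProbabilityTheory.gaussianPDFReal 0 1 (z i) := by
  have hdet : IsUnit A.det := (Matrix.isUnit_iff_isUnit_det _).1 hA
  have hq : dotProduct (A.mulVec z) ((A * A.transpose)⁻¹.mulVec (A.mulVec z)) = ∑ i, z i ^ 2 := by
    rw [Matrix.mul_inv_rev, ← Matrix.mulVec_mulVec, Matrix.mulVec_mulVec (M := A⁻¹),
      Matrix.nonsing_inv_mul _ hdet, Matrix.one_mulVec, ← Matrix.transpose_nonsing_inv,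
      Matrix.mulVec_transpose, dotProduct_comm, ← Matrix.dotProduct_mulVec, Matrix.mulVec_mulVec,
      Matrix.nonsing_inv_mul _ hdet, Matrix.one_mulVec]
    simp [dotProduct, sq]
  simp only [gaussianDensity, add_sub_cancel_right, hq, ProbabilityTheory.gaussianPDFReal,
    Finset.prod_mul_distrib, Finset.prod_const, ← Real.exp_sum]
  rw [Matrix.det_mul, Matrix.det_transpose, Real.sqrt_mul (by positivity), Real.sqrt_mul_self_eq_abs,
    mul_inv_rev, mul_assoc]
  congr 2
  · simp only [NNReal.coe_one, mul_one, Finset.card_univ, Fintype.card_fin, inv_pow]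
    congr 1
    refine (Real.sqrt_eq_iff_mul_self_eq (by positivity) (by positivity)).2 ?_
    rw [← mul_pow, Real.mul_self_sqrt (by positivity)]
  · congr 1
    simp only [NNReal.coe_one, mul_one, sub_zero, neg_div, Finset.sum_neg_distrib, ← Finset.sum_div]
    ring

lemma lintegral_gaussianDensity (μ : Fin k → ℝ) {S : Matrix (Fin k) (Fin k) ℝ} (hS : S.PosDef) :
    ∫⁻ x, ENNReal.ofReal (gaussianDensity μ S x) = 1 := by
  obtain ⟨A, hA, rfl⟩ := exists_mul_transpose_eq hS
  have hdet : A.det ≠ 0 := ((Matrix.isUnit_iff_isUnit_det _).1 hA).ne_zero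
  rw [← lintegral_add_right_eq_self _ μ,
    ← lintegral_comp_linearMap volume (L := Matrix.toLin' A) (by rwa [LinearMap.det_toLin'])]
  simp only [Matrix.toLin'_apply, gaussianDensity_mulVec μ _ hA, LinearMap.det_toLin']
  simp only [ENNReal.ofReal_mul (inv_nonneg.2 (abs_nonneg A.det))]
  rw [lintegral_const_mul' _ _ ENNReal.ofReal_ne_top, ← mul_assoc,
    ← ENNReal.ofReal_mul (abs_nonneg _), mul_inv_cancel₀ (abs_ne_zero.2 hdet),
    lintegral_prod_ofReal]
  · simp
  · exact fun _ => (ProbabilityTheory.measurable_gaussianPDFReal _ _).aestronglyMeasurable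
  · exact fun _ _ => ProbabilityTheory.gaussianPDFReal_nonneg _ _ _
  · exact fun _ => ProbabilityTheory.lintegral_gaussianPDFReal_eq_one 0 one_ne_zero

/-- Exchanging rows and columns preserves the Lebesgue measure. -/
lemma measurePreserving_swap {ι κ : Type*} [Fintype ι] [Fintype κ] :
    MeasurePreserving (Function.swap : (ι → κ → ℝ) → κ → ι → ℝ) := by
  let e : (ι → κ → ℝ) ≃L[ℝ] (κ → ι → ℝ) :=
    { toFun := Function.swap
      invFun := Function.swap
      left_inv := fun _ => rfl
      right_inv := fun _ => rfl
      map_add' := fun _ _ => rfl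
      map_smul' := fun _ _ => rfl
      continuous_toFun := by unfold Function.swap; fun_prop
      continuous_invFun := by unfold Function.swap; fun_prop }
  have hm : Measurable e := e.continuous.measurable
  refine ⟨hm, ?_⟩
  have h₁ : (volume : Measure (ι → κ → ℝ)).IsAddHaarMeasure :=
    Measure.pi.isAddHaarMeasure fun _ : ι => (volume : Measure (κ → ℝ))
  have h₂ : (volume : Measure (κ → ι → ℝ)).IsAddHaarMeasure :=
    Measure.pi.isAddHaarMeasure fun _ : κ => (volume : Measure (ι → ℝ))
  have : (Measure.map e volume).IsAddHaarMeasure := e.isAddHaarMeasure_map volume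
  -- The image measure is a Haar measure, hence a multiple of Lebesgue measure; the unit cube shows
  -- that the factor is one.
  have h := Measure.isAddLeftInvariant_eq_smul (Measure.map e volume) (volume : Measure (κ → ι → ℝ))
  have hcube := congrArg
    (fun ν => ν (Set.univ.pi fun _ : κ => Set.univ.pi fun _ : ι => Set.Icc (0 : ℝ) 1)) h
  have hpre : (e ⁻¹' (Set.univ.pi fun _ : κ => Set.univ.pi fun _ : ι => Set.Icc (0 : ℝ) 1)) =
      Set.univ.pi fun _ : ι => Set.univ.pi fun _ : κ => Set.Icc (0 : ℝ) 1 := by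
    ext x
    simp only [Set.mem_preimage, Set.mem_pi, Set.mem_univ, true_imp_iff]
    exact forall_comm
  rw [Measure.map_apply hm (MeasurableSet.univ_pi fun _ => MeasurableSet.univ_pi fun _ =>
    measurableSet_Icc), hpre] at hcube
  simp only [Measure.smul_apply, volume_pi_pi, Real.volume_Icc, sub_zero, ENNReal.ofReal_one,
    Finset.prod_const_one, ENNReal.smul_def, smul_eq_mul, mul_one, eq_comm (a := (1 : ℝ≥0∞)),
    ENNReal.coe_eq_one] at hcube
  change Measure.map e volume = _
  rw [h, hcube, one_smul]

lemma lintegral_gaussianColumnsDensity (M : Matrix (Fin k) (Fin N) ℝ)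
    {S : Matrix (Fin k) (Fin k) ℝ} (hS : S.PosDef) :
    integralMatrix (gaussianColumnsDensity M S) = 1 := by
  have h := lintegral_prod_ofReal (fun (t : Fin N) => gaussianDensity (fun i => M i t) S)
    (fun t => (continuous_gaussianDensity _ _).aestronglyMeasurable)
    (fun t => gaussianDensity_nonneg _ _) (fun t => lintegral_gaussianDensity _ hS)
  -- The density is a product over columns, while `integralMatrix` integrates over a family of rows.
  rw [← (measurePreserving_swap (ι := Fin k) (κ := Fin N)).lintegral_comp] at h
  · exact h
  · refine ENNReal.measurable_ofReal.comp (Continuous.measurable ?_)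
    exact continuous_finsetProd _ fun t _ =>
      (continuous_gaussianDensity _ _).comp (continuous_apply t)

end Gaussian

/-! ### The inverse-Wishart kernel under congruence -/

section InverseWishart

variable {k : ℕ}

lemma invWishartKernel_pos (C : Matrix (Fin k) (Fin k) ℝ) (ν : ℝ) {P : Matrix (Fin k) (Fin k) ℝ}
    (hP : P.PosDef) : 0 < invWishartKernel C ν P :=
  ENNReal.ofReal_pos.2 (mul_pos (Real.rpow_pos_of_pos hP.det_pos _) (Real.exp_pos _))

lemma measurable_invWishartKernel (C : Matrix (Fin k) (Fin k) ℝ) (ν : ℝ) :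
    Measurable fun v => invWishartKernel C ν (symMatrix v) := by
  refine ENNReal.measurable_ofReal.comp (Measurable.mul ?_ ?_)
  · exact continuous_symMatrix.matrix_det.measurable.pow_const _
  · refine Real.measurable_exp.comp (Measurable.const_mul ?_ _)
    simp only [Matrix.trace, Matrix.diag, Matrix.mul_apply]
    exact Finset.measurable_fun_sum _ fun i _ => Finset.measurable_fun_sum _ fun j _ =>
      (measurable_symMatrix_inv_apply j i).const_mul _

lemma integralPosDef_ne_zero {f : Matrix (Fin k) (Fin k) ℝ → ℝ≥0∞}
    (hm : Measurable fun v => f (symMatrix v)) (hf : ∀ P, P.PosDef → 0 < f P) :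
    integralPosDef f ≠ 0 := by
  intro h
  change ∫⁻ v in posDefCone k, f (symMatrix v) = 0 at h
  rw [setLIntegral_eq_zero_iff measurableSet_posDefCone hm] at h
  refine volume_posDefCone_ne_zero (k := k) (measure_mono_null (fun v hv => ?_) (ae_iff.1 h))
  simp only [Set.mem_ofPred_eq, not_forall]
  exact ⟨hv, (hf _ hv).ne'⟩

/-- The trace term is unchanged by cyclicity, so only the determinant contributes, through `det A ^
2`. -/
lemma invWishartKernel_congruence (ν : ℝ) {A Q : Matrix (Fin k) (Fin k) ℝ} (hA : IsUnit A)
    (hQ : Q.PosDef) : invWishartKernel (A * A.transpose) ν (A * Q * A.transpose) =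
      ENNReal.ofReal (|A.det| ^ (-(ν + k + 1))) * invWishartKernel 1 ν Q := by
  have hdet : IsUnit A.det := (Matrix.isUnit_iff_isUnit_det _).1 hA
  have hdet' : IsUnit A.transpose.det := by rwa [Matrix.det_transpose]
  have h0 : 0 < |A.det| := abs_pos.2 hdet.ne_zero
  rw [invWishartKernel, invWishartKernel, ← ENNReal.ofReal_mul (by positivity), ← mul_assoc]
  congr 2
  · rw [Matrix.det_mul, Matrix.det_mul, Matrix.det_transpose,
      show A.det * Q.det * A.det = |A.det| ^ (2 : ℝ) * Q.det by
        rw [Real.rpow_two, sq_abs]; ring, Real.mul_rpow (by positivity) hQ.det_pos.le,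
      ← Real.rpow_mul h0.le]
    congr 2
    ring
  · congr 2
    rw [Matrix.mul_inv_rev, Matrix.mul_inv_rev, Matrix.mul_assoc, Matrix.trace_mul_comm,
      ← Matrix.mul_assoc A.transpose, Matrix.mul_nonsing_inv _ hdet', Matrix.one_mul,
      Matrix.mul_assoc, Matrix.nonsing_inv_mul _ hdet, Matrix.mul_one, Matrix.one_mul]

lemma integralPosDef_invWishartKernel_mul_transpose (ν : ℝ) {A : Matrix (Fin k) (Fin k) ℝ}
    (hA : IsUnit A) : integralPosDef (invWishartKernel (A * A.transpose) ν) =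
      ENNReal.ofReal (|LinearMap.det (congruence A)| * |A.det| ^ (-(ν + k + 1))) *
        integralPosDef (invWishartKernel (1 : Matrix (Fin k) (Fin k) ℝ) ν) := by
  rw [← integralPosDef_congruence hA,
    integralPosDef_congr fun P hP => invWishartKernel_congruence ν hA hP,
    integralPosDef_const_mul ENNReal.ofReal_ne_top, ← mul_assoc, ENNReal.ofReal_mul (abs_nonneg _)]

end InverseWishart

/-! ### Splitting off one row and column -/

section Bordering

variable {k : ℕ}

/-- The matrix with upper left entry `p`, first row and column completed by `b`, and lower right
block the symmetric matrix with coordinates `v`, where `x = (v, b, p)`. -/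
def borderMatrix (x : (SymIdx k → ℝ) × (Fin k → ℝ) × ℝ) : Matrix (Fin (k + 1)) (Fin (k + 1)) ℝ :=
  Matrix.of (Fin.cons (Fin.cons x.2.2 x.2.1) fun i => Fin.cons (x.2.1 i) (symMatrix x.1 i))

lemma borderMatrix_transpose (x : (SymIdx k → ℝ) × (Fin k → ℝ) × ℝ) :
    (borderMatrix x).transpose = borderMatrix x := by
  refine Matrix.ext fun i j => ?_
  refine Fin.cases ?_ (fun i => ?_) i <;> refine Fin.cases ?_ (fun j => ?_) j
  · rfl
  · rfl
  · rfl
  · exact congrFun (congrFun (symMatrix_transpose x.1) i) j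

lemma submatrix_symMatrix_transpose {l : ℕ} (v : SymIdx l → ℝ) {ι : Type*} (f : ι → Fin l) :
    ((symMatrix v).submatrix f f).transpose = (symMatrix v).submatrix f f := by
  rw [Matrix.transpose_submatrix, symMatrix_transpose]

/-- The coordinates of a symmetric matrix, split into those of the lower right block, the first
row without its diagonal entry, and the upper left entry. -/
def borderEquiv (k : ℕ) :
    (SymIdx (k + 1) → ℝ) ≃ₗ[ℝ] (SymIdx k → ℝ) × (Fin k → ℝ) × ℝ where
  toFun v := (symCoords ((symMatrix v).submatrix Fin.succ Fin.succ),
    fun i => symMatrix v i.succ 0, symMatrix v 0 0)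
  invFun x := symCoords (borderMatrix x)
  map_add' _ _ := rfl
  map_smul' _ _ := rfl
  left_inv v := by
    refine Eq.trans (congrArg symCoords (Matrix.ext fun i j => ?_)) (symCoords_symMatrix v)
    refine Fin.cases ?_ (fun i => ?_) i <;> refine Fin.cases ?_ (fun j => ?_) j
    · rfl
    · exact congrFun (congrFun (symMatrix_transpose v) 0) j.succ
    · rfl
    · exact congrFun (congrFun (symMatrix_symCoords
        (submatrix_symMatrix_transpose v Fin.succ)) i) j
  right_inv x := by
    have h := symMatrix_symCoords (borderMatrix_transpose x)
    refine Prod.ext ?_ (Prod.ext ?_ ?_)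
    · exact (congrArg (fun P => symCoords (Matrix.submatrix P Fin.succ Fin.succ)) h).trans
        (symCoords_symMatrix x.1)
    · exact congrArg (fun P : Matrix _ _ ℝ => fun i : Fin k => P i.succ 0) h
    · exact congrArg (fun P : Matrix _ _ ℝ => P 0 0) h

/-- The equivalence that sends `0` to the second summand and `i + 1` to `i`. -/
def borderIndex (k : ℕ) : Fin k ⊕ Unit ≃ Fin (k + 1) :=
  ((finSuccEquiv k).trans (Equiv.optionEquivSumPUnit (Fin k))).symm

/-- The Schur complement of `D` is the scalar `s = p - bᵀ D⁻¹ b`. The block inverse has corner `D⁻¹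
+ s⁻¹ D⁻¹ b bᵀ D⁻¹`, whose last term has trace `s⁻¹ bᵀ D⁻² b`: a Gaussian exponent in `b` with
covariance `s D²`. -/
lemma schur_complement_trace {D : Matrix (Fin k) (Fin k) ℝ} {b : Fin k → ℝ} {p : ℝ}
    (h : (Matrix.fromBlocks D (Matrix.replicateCol Unit b) (Matrix.replicateRow Unit b)
      (Matrix.of fun _ _ => p)).PosDef) :
    D.PosDef ∧ 0 < p - dotProduct b (D⁻¹.mulVec b) ∧
    (Matrix.fromBlocks D (Matrix.replicateCol Unit b) (Matrix.replicateRow Unit b)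
      (Matrix.of fun _ _ => p)).det = D.det * (p - dotProduct b (D⁻¹.mulVec b)) ∧
    (Matrix.fromBlocks D (Matrix.replicateCol Unit b) (Matrix.replicateRow Unit b)
      (Matrix.of fun _ _ => p))⁻¹.trace = D⁻¹.trace + (p - dotProduct b (D⁻¹.mulVec b))⁻¹ +
        (p - dotProduct b (D⁻¹.mulVec b))⁻¹ * dotProduct b ((D * D)⁻¹.mulVec b) := by
  have hD : D.PosDef := h.submatrix (e := Sum.inl) Sum.inl_injective
  have hDdet := hD.det_pos
  let _ : Invertible D := hD.isUnit.invertible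
  set B := Matrix.replicateCol Unit b
  set B' := Matrix.replicateRow Unit b
  set q : Matrix Unit Unit ℝ := Matrix.of fun _ _ => p
  have hS : ∀ i j, (q - B' * ⅟D * B) i j = p - dotProduct b (D⁻¹.mulVec b) := by
    intro i j
    rw [Matrix.sub_apply, Matrix.mul_assoc, Matrix.invOf_eq_nonsing_inv]
    congr 1
  have hdet := Matrix.det_fromBlocks₁₁ D B B' q
  rw [Matrix.det_unique (q - _), hS] at hdet
  have hs : 0 < p - dotProduct b (D⁻¹.mulVec b) := by
    have := h.det_pos
    rw [hdet] at this
    exact pos_of_mul_pos_right this hDdet.le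
  refine ⟨hD, hs, hdet, ?_⟩
  let _ : Invertible (Matrix.fromBlocks D B B' q) := h.isUnit.invertible
  let _ : Invertible (q - B' * ⅟D * B) := by
    refine ((Matrix.isUnit_iff_isUnit_det _).2 ?_).invertible
    rw [Matrix.det_unique, hS]
    exact hs.ne'.isUnit
  have hinv := Matrix.invOf_fromBlocks₁₁_eq D B B' q
  have hSinv : ⅟(q - B' * ⅟D * B) =
      (p - dotProduct b (D⁻¹.mulVec b))⁻¹ • (1 : Matrix Unit Unit ℝ) := by
    rw [Matrix.invOf_eq_nonsing_inv, Matrix.inv_subsingleton]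
    ext i j
    rw [Matrix.diagonal_apply, hS]
    simp
  have htr : ∀ (E : Matrix (Fin k) (Fin k) ℝ) F G (H : Matrix Unit Unit ℝ),
      (Matrix.fromBlocks E F G H).trace = E.trace + H.trace := fun E F G H => by
    simp [Matrix.trace]
  have h1 : (D⁻¹ * B * (B' * D⁻¹)).trace = dotProduct b ((D * D)⁻¹.mulVec b) := by
    rw [Matrix.trace_mul_comm, Matrix.mul_inv_rev, Matrix.mul_assoc, ← Matrix.mul_assoc D⁻¹]
    simp [Matrix.trace]
    rfl
  rw [← Matrix.invOf_eq_nonsing_inv, hinv, htr, hSinv, Matrix.trace_add,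
    Matrix.mul_smul, Matrix.smul_mul, Matrix.smul_mul, Matrix.trace_smul, Matrix.trace_smul,
    Matrix.mul_one, Matrix.invOf_eq_nonsing_inv, Matrix.mul_assoc _ B', h1]
  simp
  ring

lemma borderEquiv_of_mem_posDefCone {v : SymIdx (k + 1) → ℝ} (hv : v ∈ posDefCone (k + 1))
    {D : SymIdx k → ℝ} {b : Fin k → ℝ} {p : ℝ} (hvx : borderEquiv k v = (D, b, p)) :
    D ∈ posDefCone k ∧ 0 < p - dotProduct b ((symMatrix D)⁻¹.mulVec b) ∧
    (symMatrix v).det = (symMatrix D).det * (p - dotProduct b ((symMatrix D)⁻¹.mulVec b)) ∧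
    (symMatrix v)⁻¹.trace = (symMatrix D)⁻¹.trace +
      (p - dotProduct b ((symMatrix D)⁻¹.mulVec b))⁻¹ +
        (p - dotProduct b ((symMatrix D)⁻¹.mulVec b))⁻¹ *
          dotProduct b ((symMatrix D * symMatrix D)⁻¹.mulVec b) := by
  have hD : symCoords ((symMatrix v).submatrix Fin.succ Fin.succ) = D := congrArg Prod.fst hvx
  have hb : (fun i => symMatrix v (Fin.succ i) 0) = b := congrArg (fun x => x.2.1) hvx
  have hp : symMatrix v 0 0 = p := congrArg (fun x => x.2.2) hvx
  have hsub : (symMatrix v).submatrix (borderIndex k) (borderIndex k) =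
      Matrix.fromBlocks (symMatrix D) (Matrix.replicateCol Unit b) (Matrix.replicateRow Unit b)
        (Matrix.of fun _ _ => p) := by
    rw [← hD, symMatrix_symCoords
      (submatrix_symMatrix_transpose v Fin.succ), ← hb, ← hp]
    ext i j
    rcases i with i | i <;> rcases j with j | j
    · rfl
    · rfl
    · exact congrFun (congrFun (symMatrix_transpose v) (0 : Fin (k + 1))) j.succ |>.symm
    · rfl
  have hpos : ((symMatrix v).submatrix (borderIndex k) (borderIndex k)).PosDef :=
    Matrix.PosDef.submatrix hv (borderIndex k).injective
  rw [hsub] at hpos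
  obtain ⟨h1, h2, h3, h4⟩ := schur_complement_trace hpos
  refine ⟨h1, h2, ?_, ?_⟩
  · rw [← h3, ← hsub, Matrix.det_submatrix_equiv_self]
  · rw [← h4, ← hsub, Matrix.inv_submatrix_equiv]
    exact ((borderIndex k).sum_comp fun i => (symMatrix v)⁻¹ i i).symm

end Bordering

/-! ### Finiteness of the inverse-Wishart integral -/

section Finiteness

variable {k : ℕ}

lemma lintegral_exp_neg_quadratic {S : Matrix (Fin k) (Fin k) ℝ} (hS : S.PosDef) :
    ∫⁻ b : Fin k → ℝ, ENNReal.ofReal (Real.exp (-(1 / 2) * dotProduct b (S⁻¹.mulVec b))) =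
      ENNReal.ofReal (√((2 * Real.pi) ^ k * S.det)) := by
  have hpos : 0 < √((2 * Real.pi) ^ k * S.det) :=
    Real.sqrt_pos.2 (mul_pos (by positivity) hS.det_pos)
  have h : ∀ b : Fin k → ℝ,
      ENNReal.ofReal (Real.exp (-(1 / 2) * dotProduct b (S⁻¹.mulVec b))) =
      ENNReal.ofReal (√((2 * Real.pi) ^ k * S.det)) * ENNReal.ofReal (gaussianDensity 0 S b) := by
    intro b
    rw [← ENNReal.ofReal_mul hpos.le, gaussianDensity, ← mul_assoc, mul_inv_cancel₀ hpos.ne',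
      one_mul, sub_zero]
  simp only [h]
  rw [lintegral_const_mul' _ _ ENNReal.ofReal_ne_top, lintegral_gaussianDensity _ hS, mul_one]

/-- The substitution `s ↦ s⁻¹` gives a Gamma integral with exponent `c - 2 > -1`. -/
lemma lintegral_rpow_mul_exp_neg_inv_lt_top {c : ℝ} (hc : 1 < c) :
    ∫⁻ s in Set.Ioi (0 : ℝ), ENNReal.ofReal (s ^ (-c) * Real.exp (-(1 / 2) * s⁻¹)) < ∞ := by
  have h1 := integrableOn_rpow_mul_exp_neg_mul_rpow (p := 1) (s := c - 2) (b := 1 / 2)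
    (by linarith) one_pos (by norm_num)
  rw [← integrableOn_Ioi_comp_rpow_iff _ (p := -1) (by norm_num)] at h1
  have h2 : IntegrableOn (fun s : ℝ => s ^ (-c) * Real.exp (-(1 / 2) * s⁻¹)) (Set.Ioi 0) := by
    refine h1.congr_fun (fun s hs => ?_) measurableSet_Ioi
    have hs : (0 : ℝ) < s := hs
    simp only [abs_neg, abs_one, one_mul, smul_eq_mul, Real.rpow_one]
    rw [← mul_assoc, ← Real.rpow_mul hs.le, ← Real.rpow_add hs, Real.rpow_neg_one]
    congr 2
    ring
  have h3 := h2.lintegral_lt_top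
  exact h3

/-- The inverse-Wishart kernel in bordered coordinates, with the Schur complement `s` in place of
the upper left entry. -/
noncomputable def borderKernel (a : ℝ) (D : Matrix (Fin k) (Fin k) ℝ) (b : Fin k → ℝ) (s : ℝ) :
    ℝ≥0∞ :=
  ENNReal.ofReal (D.det ^ (-a) * Real.exp (-(1 / 2) * D⁻¹.trace)) *
    (Set.Ioi (0 : ℝ)).indicator (fun s => ENNReal.ofReal (s ^ (-a) * Real.exp (-(1 / 2) * s⁻¹)) *
      ENNReal.ofReal (Real.exp (-(1 / 2) * dotProduct b ((s • (D * D))⁻¹.mulVec b)))) s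

lemma posDef_smul_mul_self {D : Matrix (Fin k) (Fin k) ℝ} (hD : D.PosDef) {s : ℝ} (hs : 0 < s) :
    (s • (D * D)).PosDef := by
  refine Matrix.PosDef.smul ?_ hs
  have := Matrix.PosDef.conjTranspose_mul_self D
    (Matrix.mulVec_injective_iff_isUnit.2 hD.isUnit)
  rwa [hD.1] at this

lemma inv_smul_mul_self {D : Matrix (Fin k) (Fin k) ℝ} (hD : D.PosDef) {s : ℝ} (hs : 0 < s) :
    (s • (D * D))⁻¹ = s⁻¹ • (D * D)⁻¹ := by
  let _ := invertibleOfNonzero hs.ne'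
  rw [Matrix.inv_smul _ _ (by rw [Matrix.det_mul]; exact
    (mul_pos hD.det_pos hD.det_pos).ne'.isUnit), invOf_eq_inv]

/-- By Tonelli `b` is integrated first, with covariance `s D²`. This yields `(2π)^(k/2) s^(k/2) det
D`, which shifts the exponent of `s` by `k / 2` and that of `det D` by one. -/
lemma lintegral_borderKernel {a : ℝ} {D : Matrix (Fin k) (Fin k) ℝ} (hD : D.PosDef) :
    ∫⁻ b : Fin k → ℝ, ∫⁻ s, borderKernel a D b s =
      (ENNReal.ofReal (√((2 * Real.pi) ^ k)) * ∫⁻ s in Set.Ioi (0 : ℝ),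
        ENNReal.ofReal (s ^ (-(a - k / 2)) * Real.exp (-(1 / 2) * s⁻¹))) *
      ENNReal.ofReal (D.det ^ (-(a - 1)) * Real.exp (-(1 / 2) * D⁻¹.trace)) := by
  have hmeas : AEMeasurable (Function.uncurry fun (b : Fin k → ℝ) (s : ℝ) =>
      ENNReal.ofReal (s ^ (-a) * Real.exp (-(1 / 2) * s⁻¹)) *
      ENNReal.ofReal (Real.exp (-(1 / 2) * (s⁻¹ * dotProduct b ((D * D)⁻¹.mulVec b)))))
      ((volume : Measure (Fin k → ℝ)).prod (volume.restrict (Set.Ioi (0 : ℝ)))) := by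
    have hq : Measurable fun x : (Fin k → ℝ) × ℝ => dotProduct x.1 ((D * D)⁻¹.mulVec x.1) :=
      (Continuous.dotProduct continuous_fst
        (Continuous.matrix_mulVec continuous_const continuous_fst)).measurable
    unfold Function.uncurry
    fun_prop
  have hs : ∀ (s : ℝ) (_ : s ∈ Set.Ioi (0 : ℝ)) (b : Fin k → ℝ),
      dotProduct b ((s • (D * D))⁻¹.mulVec b) = s⁻¹ * dotProduct b ((D * D)⁻¹.mulVec b) := by
    intro s hs b
    rw [inv_smul_mul_self hD hs, Matrix.smul_mulVec, dotProduct_smul, smul_eq_mul]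
  simp only [borderKernel, lintegral_const_mul' _ _ ENNReal.ofReal_ne_top,
    lintegral_indicator measurableSet_Ioi]
  have h1 : ∀ b : Fin k → ℝ, ∫⁻ s in Set.Ioi (0 : ℝ),
      ENNReal.ofReal (s ^ (-a) * Real.exp (-(1 / 2) * s⁻¹)) *
      ENNReal.ofReal (Real.exp (-(1 / 2) * dotProduct b ((s • (D * D))⁻¹.mulVec b))) =
      ∫⁻ s in Set.Ioi (0 : ℝ),
      ENNReal.ofReal (s ^ (-a) * Real.exp (-(1 / 2) * s⁻¹)) *
      ENNReal.ofReal (Real.exp (-(1 / 2) * (s⁻¹ * dotProduct b ((D * D)⁻¹.mulVec b)))) :=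
    fun b => setLIntegral_congr_fun measurableSet_Ioi fun s hs' => by
      simp only [hs s hs' b]
  simp only [h1]
  rw [lintegral_lintegral_swap hmeas]
  have h2 : ∫⁻ s in Set.Ioi (0 : ℝ), ∫⁻ b : Fin k → ℝ,
      ENNReal.ofReal (s ^ (-a) * Real.exp (-(1 / 2) * s⁻¹)) *
      ENNReal.ofReal (Real.exp (-(1 / 2) * (s⁻¹ * dotProduct b ((D * D)⁻¹.mulVec b)))) =
      ∫⁻ s in Set.Ioi (0 : ℝ), ENNReal.ofReal (√((2 * Real.pi) ^ k) * D.det) *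
        ENNReal.ofReal (s ^ (-(a - k / 2)) * Real.exp (-(1 / 2) * s⁻¹)) := by
    refine setLIntegral_congr_fun measurableSet_Ioi fun s hs' => ?_
    have hs0 : 0 < s := hs'
    simp only [← hs s hs']
    rw [lintegral_const_mul' _ _ ENNReal.ofReal_ne_top,
      lintegral_exp_neg_quadratic (posDef_smul_mul_self hD hs'),
      ← ENNReal.ofReal_mul (by positivity),
      ← ENNReal.ofReal_mul (mul_nonneg (by positivity) hD.det_pos.le)]
    congr 1
    rw [Matrix.det_smul, Matrix.det_mul, Fintype.card_fin, Real.sqrt_mul (by positivity),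
      Real.sqrt_mul (by positivity), Real.sqrt_mul_self hD.det_pos.le, Real.sqrt_eq_rpow (s ^ k),
      ← Real.rpow_natCast s k, ← Real.rpow_mul hs0.le, neg_sub, sub_eq_add_neg,
      Real.rpow_add hs0, mul_one_div]
    ring
  rw [h2, lintegral_const_mul' _ _ ENNReal.ofReal_ne_top,
    ENNReal.ofReal_mul (by positivity : 0 ≤ √((2 * Real.pi) ^ k)),
    show -(a - 1) = 1 + -a by ring, Real.rpow_add hD.det_pos, Real.rpow_one, mul_assoc D.det,
    ENNReal.ofReal_mul (p := D.det) hD.det_pos.le]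
  ring

lemma invWishartKernel_one_eq_borderKernel {ν : ℝ} {v : SymIdx (k + 1) → ℝ}
    (hv : v ∈ posDefCone (k + 1)) {D : SymIdx k → ℝ} {b : Fin k → ℝ} {p : ℝ}
    (hvx : borderEquiv k v = (D, b, p)) :
    invWishartKernel 1 ν (symMatrix v) = borderKernel ((ν + k + 2) / 2) (symMatrix D) b
      (p - dotProduct b ((symMatrix D)⁻¹.mulVec b)) := by
  obtain ⟨hD, hs, hdet, htr⟩ := borderEquiv_of_mem_posDefCone hv hvx
  have hDdet := Matrix.PosDef.det_pos hD
  rw [borderKernel, Set.indicator_of_mem (Set.mem_Ioi.2 hs), invWishartKernel, Matrix.one_mul, htr,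
    hdet, inv_smul_mul_self hD hs, Matrix.smul_mulVec, dotProduct_smul, smul_eq_mul,
    ← ENNReal.ofReal_mul (by positivity), ← ENNReal.ofReal_mul (by positivity),
    Real.mul_rpow hDdet.le hs.le, mul_add, mul_add, Real.exp_add, Real.exp_add]
  have : -(ν + ((k + 1 : ℕ) : ℝ) + 1) / 2 = -((ν + k + 2) / 2) := by push_cast; ring
  rw [this]
  congr 1
  ring

/-- Uniqueness of Haar measure. The value of `c` is irrelevant, since only finiteness is deduced
from it. -/
lemma exists_lintegral_comp_linearEquiv {E F : Type*} [NormedAddCommGroup E] [NormedSpace ℝ E]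
    [FiniteDimensional ℝ E] [MeasurableSpace E] [BorelSpace E] [NormedAddCommGroup F]
    [NormedSpace ℝ F] [FiniteDimensional ℝ F] [MeasurableSpace F] [BorelSpace F]
    (μ : Measure E) [μ.IsAddHaarMeasure] (ν : Measure F) [ν.IsAddHaarMeasure] (e : E ≃ₗ[ℝ] F) :
    ∃ c : ℝ≥0∞, c ≠ ∞ ∧ ∀ f : F → ℝ≥0∞, ∫⁻ x, f (e x) ∂μ = c * ∫⁻ y, f y ∂ν := by
  have : (μ.map e.toContinuousLinearEquiv).IsAddHaarMeasure :=
    e.toContinuousLinearEquiv.isAddHaarMeasure_map μ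
  have h := Measure.isAddLeftInvariant_eq_smul (μ.map e.toContinuousLinearEquiv) ν
  generalize (μ.map e.toContinuousLinearEquiv).addHaarScalarFactor ν = c at h
  refine ⟨c, ENNReal.coe_ne_top, fun f => ?_⟩
  have h1 := lintegral_map_equiv (μ := μ) f e.toContinuousLinearEquiv.toHomeomorph.toMeasurableEquiv
  refine h1.symm.trans ?_
  change ∫⁻ y, f y ∂(μ.map e.toContinuousLinearEquiv) = _
  rw [h, lintegral_smul_measure]
  rfl

lemma integralPosDef_invWishartKernel_one_lt_top (k : ℕ) :
    ∀ ν : ℝ, (k : ℝ) - 1 < ν →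
      integralPosDef (invWishartKernel (1 : Matrix (Fin k) (Fin k) ℝ) ν) < ∞ := by
  induction k with
  | zero =>
    intro ν _
    refine lt_of_le_of_lt (setLIntegral_le_lintegral _ _) ?_
    rw [lintegral_unique]
    exact ENNReal.mul_lt_top ENNReal.ofReal_lt_top (by simp [volume_pi])
  | succ k ih =>
    intro ν hν
    have hk : (0 : ℝ) ≤ k := k.cast_nonneg
    push_cast at hν
    let G : (SymIdx k → ℝ) × (Fin k → ℝ) × ℝ → ℝ≥0∞ := fun x =>
      (posDefCone k).indicator (fun D => borderKernel ((ν + k + 2) / 2) (symMatrix D) x.2.1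
        (x.2.2 - dotProduct x.2.1 ((symMatrix D)⁻¹.mulVec x.2.1))) x.1
    have hH : ((volume : Measure (Fin k → ℝ)).prod (volume : Measure ℝ)).IsAddHaarMeasure :=
      Measure.prod.instIsAddHaarMeasure _ _
    have hH' : ((volume : Measure (SymIdx k → ℝ)).prod
        ((volume : Measure (Fin k → ℝ)).prod (volume : Measure ℝ))).IsAddHaarMeasure :=
      Measure.prod.instIsAddHaarMeasure _ _
    obtain ⟨c, hc, hcG⟩ := exists_lintegral_comp_linearEquiv volume
      ((volume : Measure (SymIdx k → ℝ)).prod ((volume : Measure (Fin k → ℝ)).prod volume))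
      (borderEquiv k)
    -- An upper bound suffices, so it is enough that positive definiteness forces `D ≻ 0` and `s >
    -- 0`; the converse is not used.
    have h1 : integralPosDef (invWishartKernel (1 : Matrix (Fin (k + 1)) (Fin (k + 1)) ℝ) ν) ≤
        c * ∫⁻ x, G x := by
      refine le_trans ?_ (hcG G).le
      rw [integralPosDef_eq_lintegral_indicator]
      refine lintegral_mono fun v => ?_
      by_cases hv : v ∈ posDefCone (k + 1)
      · rcases hvx : borderEquiv k v with ⟨D, b, p⟩
        have hD := (borderEquiv_of_mem_posDefCone hv hvx).1
        rw [Set.indicator_of_mem hv, invWishartKernel_one_eq_borderKernel hv hvx]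
        simp only [G, Set.indicator_of_mem hD, le_refl]
      · rw [Set.indicator_of_notMem hv]
        exact bot_le
    refine h1.trans_lt (ENNReal.mul_lt_top hc.lt_top ?_)
    -- This direction of Tonelli requires no measurability of `G`.
    have h2 : ∫⁻ x, G x ≤ ∫⁻ D, ∫⁻ b, ∫⁻ p, G (D, b, p) :=
      (lintegral_prod_le _).trans (lintegral_mono fun D => lintegral_prod_le _)
    refine h2.trans_lt ?_
    set J := ENNReal.ofReal (√((2 * Real.pi) ^ k)) * ∫⁻ s in Set.Ioi (0 : ℝ),
        ENNReal.ofReal (s ^ (-((ν + k + 2) / 2 - k / 2)) * Real.exp (-(1 / 2) * s⁻¹)) with hJ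
    have hJtop : J < ∞ := ENNReal.mul_lt_top ENNReal.ofReal_lt_top
      (lintegral_rpow_mul_exp_neg_inv_lt_top (by linarith))
    have h3 : ∀ D, ∫⁻ b, ∫⁻ p, G (D, b, p) = (posDefCone k).indicator
        (fun D => J * invWishartKernel 1 (ν - 1) (symMatrix D)) D := by
      intro D
      by_cases hD : D ∈ posDefCone k
      · simp only [G, Set.indicator_of_mem hD]
        -- For fixed `D` and `b`, passing from `p` to the Schur complement is a translation.
        have h4 : ∀ b : Fin k → ℝ, ∫⁻ p, borderKernel ((ν + k + 2) / 2) (symMatrix D) b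
            (p - dotProduct b ((symMatrix D)⁻¹.mulVec b)) =
            ∫⁻ s, borderKernel ((ν + k + 2) / 2) (symMatrix D) b s := fun b =>
          lintegral_sub_right_eq_self _ _
        simp only [h4]
        rw [lintegral_borderKernel hD, invWishartKernel, Matrix.one_mul, ← hJ,
          show -((ν + k + 2) / 2 - 1) = -(ν - 1 + k + 1) / 2 by ring]
      · simp [G, Set.indicator_of_notMem hD]
    simp only [h3]
    rw [← integralPosDef_eq_lintegral_indicator (fun P => J * invWishartKernel 1 (ν - 1) P),
      integralPosDef_const_mul hJtop.ne]
    exact ENNReal.mul_lt_top hJtop (ih _ (by linarith))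

end Finiteness

/-! ### The scaling law in the scale matrix -/

section Scaling

variable {k : ℕ}

lemma integralPosDef_invWishartKernel_one_ne_zero (ν : ℝ) :
    integralPosDef (invWishartKernel (1 : Matrix (Fin k) (Fin k) ℝ) ν) ≠ 0 :=
  integralPosDef_ne_zero (measurable_invWishartKernel 1 ν) fun _ => invWishartKernel_pos 1 ν

lemma abs_det_eq_one_of_mul_transpose {O : Matrix (Fin k) (Fin k) ℝ} (hO : O * O.transpose = 1) :
    |O.det| = 1 := by
  have := congrArg Matrix.det hO
  rw [Matrix.det_mul, Matrix.det_transpose, Matrix.det_one, ← abs_mul_abs_self] at this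
  nlinarith [abs_nonneg O.det]

/-- Since `O Oᵀ = 1`, the substitution maps the integral of the kernel at `C = 1` to itself times
the Jacobian, and a finite nonzero integral cancels. -/
lemma abs_det_congruence_orthogonal {O : Matrix (Fin k) (Fin k) ℝ} (hO : O * O.transpose = 1) :
    |LinearMap.det (congruence O)| = 1 := by
  have hu : IsUnit O := IsUnit.of_mul_eq_one _ hO
  have hdet := abs_det_eq_one_of_mul_transpose hO
  -- The choice `ν = k` is arbitrary; any value above `k - 1` serves.
  have h := integralPosDef_invWishartKernel_mul_transpose k hu
  rw [hO, hdet, Real.one_rpow, mul_one] at h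
  have h0 := integralPosDef_invWishartKernel_one_ne_zero (k := k) k
  have htop := (integralPosDef_invWishartKernel_one_lt_top k k (by linarith)).ne
  have h1 : 1 = ENNReal.ofReal |LinearMap.det (congruence O)| :=
    (ENNReal.mul_left_inj h0 htop).1 (by rw [one_mul]; exact h)
  simpa using h1.symm

lemma integralPosDef_invWishartKernel {C : Matrix (Fin k) (Fin k) ℝ} (hC : C.PosDef) (ν : ℝ) :
    integralPosDef (invWishartKernel C ν) = ENNReal.ofReal (C.det ^ (-ν / 2)) *
      integralPosDef (invWishartKernel (1 : Matrix (Fin k) (Fin k) ℝ) ν) := by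
  obtain ⟨O, d, hO, hd, rfl⟩ := exists_orthogonal_mul_diagonal hC
  have hOdet := abs_det_eq_one_of_mul_transpose hO
  have hp : 0 < ∏ i, d i := Finset.prod_pos fun i _ => hd i
  have hu : IsUnit (O * Matrix.diagonal d) := by
    rw [Matrix.isUnit_iff_isUnit_det, Matrix.det_mul, Matrix.det_diagonal, isUnit_iff_ne_zero]
    refine mul_ne_zero (abs_pos.1 (by rw [hOdet]; exact one_pos)) hp.ne'
  rw [integralPosDef_invWishartKernel_mul_transpose ν hu, det_congruence_mul, abs_mul,
    abs_det_congruence_orthogonal hO, det_congruence_diagonal, Matrix.det_mul (O * _),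
    Matrix.det_transpose, Matrix.det_mul, Matrix.det_diagonal, ← abs_mul_abs_self, abs_mul, hOdet,
    one_mul, one_mul, abs_of_pos (pow_pos hp _), abs_of_pos hp]
  -- The Jacobian `(∏ d)^(k+1)` against `(∏ d)^(-(ν+k+1))` leaves `(∏ d)^(-ν)`, and `det C = (∏
  -- d)^2`.
  congr 2
  rw [← Real.rpow_natCast, ← Real.rpow_add hp, ← sq, ← Real.rpow_natCast _ 2,
    ← Real.rpow_mul hp.le]
  congr 1
  push_cast
  ring

lemma integralPosDef_invWishartKernel_ne_zero {C : Matrix (Fin k) (Fin k) ℝ} (ν : ℝ) :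
    integralPosDef (invWishartKernel C ν) ≠ 0 :=
  integralPosDef_ne_zero (measurable_invWishartKernel C ν) fun _ => invWishartKernel_pos C ν

lemma integralPosDef_invWishartKernel_ne_top {C : Matrix (Fin k) (Fin k) ℝ} (hC : C.PosDef)
    {ν : ℝ} (hν : (k : ℝ) - 1 < ν) : integralPosDef (invWishartKernel C ν) ≠ ∞ := by
  rw [integralPosDef_invWishartKernel hC]
  exact (ENNReal.mul_lt_top ENNReal.ofReal_lt_top
    (integralPosDef_invWishartKernel_one_lt_top k ν hν)).ne

lemma invWishartDensity_ne_top (C : Matrix (Fin k) (Fin k) ℝ) (ν : ℝ)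
    (P : Matrix (Fin k) (Fin k) ℝ) : invWishartDensity C ν P ≠ ∞ :=
  ENNReal.div_ne_top ENNReal.ofReal_ne_top (integralPosDef_invWishartKernel_ne_zero ν)

lemma integralPosDef_invWishartDensity {C : Matrix (Fin k) (Fin k) ℝ} (hC : C.PosDef)
    {ν : ℝ} (hν : (k : ℝ) - 1 < ν) : integralPosDef (invWishartDensity C ν) = 1 := by
  have h0 := integralPosDef_invWishartKernel_ne_zero (C := C) ν
  have htop := integralPosDef_invWishartKernel_ne_top hC hν
  unfold invWishartDensity
  simp only [ENNReal.div_eq_inv_mul]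
  rw [integralPosDef_const_mul (ENNReal.inv_ne_top.2 h0), ENNReal.inv_mul_cancel h0 htop]

end Scaling

/-! ### Determinant identities and growth -/

section Determinant

variable {k N : ℕ}

lemma posSemidef_mul_transpose (Z : Matrix (Fin k) (Fin N) ℝ) : (Z * Z.transpose).PosSemidef :=
  Matrix.posSemidef_self_mul_conjTranspose Z

lemma posDef_mul_transpose_add (Z : Matrix (Fin k) (Fin N) ℝ) {C : Matrix (Fin k) (Fin k) ℝ}
    (hC : C.PosDef) : (Z * Z.transpose + C).PosDef :=
  Matrix.PosDef.posSemidef_add (posSemidef_mul_transpose Z) hC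

lemma det_mul_transpose_add (Z : Matrix (Fin k) (Fin N) ℝ) {C : Matrix (Fin k) (Fin k) ℝ}
    (hC : C.PosDef) :
    (Z * Z.transpose + C).det = C.det * (1 + Z.transpose * C⁻¹ * Z).det := by
  have hdet : IsUnit C.det := hC.det_pos.ne'.isUnit
  have : Z * Z.transpose + C = C * (1 + C⁻¹ * Z * Z.transpose) := by
    rw [mul_add, Matrix.mul_one, Matrix.mul_assoc C⁻¹, ← Matrix.mul_assoc C,
      Matrix.mul_nonsing_inv _ hdet, Matrix.one_mul, add_comm]
  rw [this, Matrix.det_mul, Matrix.det_one_add_mul_comm, ← Matrix.mul_assoc]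

lemma one_add_sum_le_prod_one_add {ι : Type*} (s : Finset ι) {f : ι → ℝ} (hf : ∀ i, 0 ≤ f i) :
    1 + ∑ i ∈ s, f i ≤ ∏ i ∈ s, (1 + f i) := by
  classical
  induction s using Finset.induction_on with
  | empty => simp
  | insert a s ha ih =>
    rw [Finset.sum_insert ha, Finset.prod_insert ha]
    have h1 : 0 ≤ ∑ i ∈ s, f i := Finset.sum_nonneg fun i _ => hf i
    nlinarith [hf a, mul_nonneg (hf a) h1, mul_le_mul_of_nonneg_left ih (by
      linarith [hf a] : 0 ≤ 1 + f a)]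

/-- In terms of eigenvalues this is `1 + ∑ d i ≤ ∏ (1 + d i)` for nonnegative `d i`. -/
lemma one_add_trace_le_det_one_add {A : Matrix (Fin k) (Fin k) ℝ} (hA : A.PosSemidef) :
    1 + A.trace ≤ (1 + A).det := by
  obtain ⟨U, d, hU, hd, rfl⟩ : ∃ (U : Matrix (Fin k) (Fin k) ℝ) (d : Fin k → ℝ),
      star U * U = 1 ∧ (∀ i, 0 ≤ d i) ∧ A = U * Matrix.diagonal d * star U :=
    ⟨hA.1.eigenvectorUnitary.1, hA.1.eigenvalues, Unitary.coe_star_mul_self _,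
      hA.eigenvalues_nonneg, hA.1.spectral_theorem⟩
  have hdet : (1 + U * Matrix.diagonal d * star U).det = ∏ i, (1 + d i) := by
    rw [Matrix.mul_assoc, Matrix.det_one_add_mul_comm, Matrix.mul_assoc, hU, Matrix.mul_one,
      ← Matrix.diagonal_one, Matrix.diagonal_add, Matrix.det_diagonal]
  have htr : (U * Matrix.diagonal d * star U).trace = ∑ i, d i := by
    rw [Matrix.trace_mul_comm, ← Matrix.mul_assoc, hU, Matrix.one_mul, Matrix.trace_diagonal]
  rw [hdet, htr]
  exact one_add_sum_le_prod_one_add _ hd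

lemma posSemidef_transpose_mul_inv_mul (Z : Matrix (Fin k) (Fin N) ℝ)
    {C : Matrix (Fin k) (Fin k) ℝ} (hC : C.PosDef) : (Z.transpose * C⁻¹ * Z).PosSemidef :=
  hC.inv.posSemidef.conjTranspose_mul_mul_same Z

lemma one_le_det_one_add (Z : Matrix (Fin k) (Fin N) ℝ) {C : Matrix (Fin k) (Fin k) ℝ}
    (hC : C.PosDef) : 1 ≤ (1 + Z.transpose * C⁻¹ * Z).det := by
  have h := posSemidef_transpose_mul_inv_mul Z hC
  linarith [one_add_trace_le_det_one_add h, h.trace_nonneg]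

lemma tendsto_trace_transpose_mul_self_cocompact :
    Filter.Tendsto (fun Z : Matrix (Fin k) (Fin N) ℝ => (Z.transpose * Z).trace)
      (Filter.cocompact _) Filter.atTop := by
  have h : Filter.Tendsto (fun Z : Fin k → Fin N → ℝ => ‖Z‖ ^ 2)
      (Filter.cocompact _) Filter.atTop :=
    (Filter.tendsto_pow_atTop two_ne_zero).comp tendsto_norm_cocompact_atTop
  refine Filter.tendsto_atTop_mono (fun Z : Fin k → Fin N → ℝ => ?_) h
  have htr : ((Matrix.of Z).transpose * Matrix.of Z).trace = ∑ j, ∑ i, Z i j ^ 2 := by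
    simp [Matrix.trace, Matrix.mul_apply, sq]
  refine le_of_le_of_eq ?_ htr.symm
  have h0 : 0 ≤ ∑ j, ∑ i, Z i j ^ 2 :=
    Finset.sum_nonneg fun j _ => Finset.sum_nonneg fun i _ => sq_nonneg _
  rw [← Real.sq_sqrt h0]
  refine pow_le_pow_left₀ (norm_nonneg _) ?_ 2
  refine (pi_norm_le_iff_of_nonneg (Real.sqrt_nonneg _)).2 fun i =>
    (pi_norm_le_iff_of_nonneg (Real.sqrt_nonneg _)).2 fun j => ?_
  refine Real.le_sqrt_of_sq_le ?_
  rw [Real.norm_eq_abs, sq_abs]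
  exact (Finset.single_le_sum (f := fun i => Z i j ^ 2) (fun i _ => sq_nonneg _)
    (Finset.mem_univ i)).trans (Finset.single_le_sum (f := fun j => ∑ i, Z i j ^ 2)
      (fun j _ => Finset.sum_nonneg fun i _ => sq_nonneg _) (Finset.mem_univ j))

/-- With `C⁻¹ = A Aᵀ`, the affine homeomorphism `X ↦ Aᵀ (X - U)` preserves escape to infinity and
reduces the claim to the growth of `tr(Zᵀ Z)`. -/
lemma tendsto_det_one_add_cocompact (U : Matrix (Fin k) (Fin N) ℝ) {C : Matrix (Fin k) (Fin k) ℝ}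
    (hC : C.PosDef) :
    Filter.Tendsto (fun X : Matrix (Fin k) (Fin N) ℝ =>
      (1 + (X - U).transpose * C⁻¹ * (X - U)).det) (Filter.cocompact _) Filter.atTop := by
  obtain ⟨A, hA, hCA⟩ := exists_mul_transpose_eq hC.inv
  have hdet : IsUnit A.transpose.det := by
    rw [Matrix.det_transpose]; exact (Matrix.isUnit_iff_isUnit_det _).1 hA
  let e : Matrix (Fin k) (Fin N) ℝ ≃ₜ Matrix (Fin k) (Fin N) ℝ :=
    { toFun := fun X => A.transpose * (X - U)
      invFun := fun Z => A.transpose⁻¹ * Z + U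
      left_inv := fun X => by
        simp [← Matrix.mul_assoc, Matrix.nonsing_inv_mul _ hdet]
      right_inv := fun Z => by
        simp [← Matrix.mul_assoc, Matrix.mul_nonsing_inv _ hdet]
      continuous_toFun := by fun_prop
      continuous_invFun := by fun_prop }
  refine Filter.tendsto_atTop_mono (fun X => ?_)
    (tendsto_trace_transpose_mul_self_cocompact.comp e.isClosedEmbedding.tendsto_cocompact)
  have h : (X - U).transpose * C⁻¹ * (X - U) = (e X).transpose * e X := by
    change _ = (A.transpose * (X - U)).transpose * (A.transpose * (X - U))
    rw [hCA, Matrix.transpose_mul, Matrix.transpose_transpose]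
    simp only [Matrix.mul_assoc]
  have h' := one_add_trace_le_det_one_add (posSemidef_transpose_mul_inv_mul (X - U) hC)
  rw [h] at h' ⊢
  simp only [Function.comp_apply]
  linarith

end Determinant

/-! ### Gaussian columns with the covariance integrated out -/

section Marginal

variable {k N : ℕ}

lemma gaussianColumnsDensity_zero_sub (M Z : Matrix (Fin k) (Fin N) ℝ)
    (S : Matrix (Fin k) (Fin k) ℝ) :
    gaussianColumnsDensity 0 S (Z - M) = gaussianColumnsDensity M S Z := by
  have h : ∀ t, ((fun i => (Z - M) i t) - fun i => (0 : Matrix (Fin k) (Fin N) ℝ) i t) =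
      (fun i => Z i t) - fun i => M i t := fun t => by ext i; simp
  simp only [gaussianColumnsDensity, gaussianDensity, h]

/-- Each column contributes `|P|^(-1/2)`, raising `ν` by one, and a rank-one term to the scale
matrix. -/
lemma gaussianColumnsDensity_mul_invWishartKernel (M Z : Matrix (Fin k) (Fin N) ℝ)
    (C : Matrix (Fin k) (Fin k) ℝ) (ν : ℝ) {P : Matrix (Fin k) (Fin k) ℝ} (hP : P.PosDef) :
    gaussianColumnsDensity M P Z * invWishartKernel C ν P =
      ENNReal.ofReal ((√((2 * Real.pi) ^ k))⁻¹ ^ N) *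
        invWishartKernel ((Z - M) * (Z - M).transpose + C) (ν + N) P := by
  have hdet := hP.det_pos
  have htr : ∑ t, dotProduct ((fun i => Z i t) - fun i => M i t)
      (P⁻¹.mulVec ((fun i => Z i t) - fun i => M i t)) =
      ((Z - M) * (Z - M).transpose * P⁻¹).trace := by
    rw [Matrix.mul_assoc, Matrix.trace_mul_comm, Matrix.mul_assoc]
    rfl
  have hpow : P.det ^ (-(ν + N + k + 1) / 2) =
      (√P.det)⁻¹ ^ N * P.det ^ (-(ν + k + 1) / 2) := by
    rw [Real.sqrt_eq_rpow, ← Real.rpow_neg hdet.le, ← Real.rpow_natCast, ← Real.rpow_mul hdet.le,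
      ← Real.rpow_add hdet]
    congr 1
    ring
  rw [gaussianColumnsDensity, invWishartKernel, invWishartKernel,
    ← ENNReal.ofReal_mul (Finset.prod_nonneg fun t _ => gaussianDensity_nonneg _ _ _),
    ← ENNReal.ofReal_mul (by positivity), hpow]
  congr 1
  simp only [gaussianDensity, Finset.prod_mul_distrib, Finset.prod_const, ← Real.exp_sum,
    ← Finset.mul_sum, htr, Finset.card_univ, Fintype.card_fin]
  rw [add_mul, Matrix.trace_add, mul_add, Real.exp_add, Real.sqrt_mul (by positivity), mul_inv,
    mul_pow]
  ring

/-- The density at `Z` of a matrix with independent `N(M_t, P)` columns, where `P` has the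
distribution `W⁻¹(C, ν)` and is integrated out. -/
noncomputable def columnsMarginal (M : Matrix (Fin k) (Fin N) ℝ) (C : Matrix (Fin k) (Fin k) ℝ)
    (ν : ℝ) (Z : Matrix (Fin k) (Fin N) ℝ) : ℝ≥0∞ :=
  integralPosDef fun P => gaussianColumnsDensity M P Z * invWishartDensity C ν P

/-- The constant is uniform in `M` as well as `Z`: the likelihood uses `M = H X`, which varies with
`X`. -/
lemma exists_columnsMarginal_eq {C : Matrix (Fin k) (Fin k) ℝ} (hC : C.PosDef) {ν : ℝ}
    (hν : (k : ℝ) - 1 < ν) : ∃ c : ℝ, 0 < c ∧ ∀ M Z : Matrix (Fin k) (Fin N) ℝ,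
      columnsMarginal M C ν Z =
        ENNReal.ofReal (c * ((Z - M) * (Z - M).transpose + C).det ^ (-(ν + N) / 2)) := by
  set I := integralPosDef (invWishartKernel C ν)
  set I₁ := integralPosDef (invWishartKernel (1 : Matrix (Fin k) (Fin k) ℝ) (ν + N))
  have hI0 : I ≠ 0 := integralPosDef_invWishartKernel_ne_zero ν
  have hI : I ≠ ∞ := integralPosDef_invWishartKernel_ne_top hC hν
  have hN : (0 : ℝ) ≤ N := N.cast_nonneg
  have hI₁0 : I₁ ≠ 0 := integralPosDef_invWishartKernel_one_ne_zero _
  have hI₁ : I₁ ≠ ∞ := (integralPosDef_invWishartKernel_one_lt_top k _ (by linarith)).ne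
  have hq : I⁻¹ * I₁ ≠ ∞ := ENNReal.mul_ne_top (ENNReal.inv_ne_top.2 hI0) hI₁
  have hq0 : I⁻¹ * I₁ ≠ 0 := mul_ne_zero (ENNReal.inv_ne_zero.2 hI) hI₁0
  have hg : 0 < (√((2 * Real.pi) ^ k))⁻¹ ^ N := by positivity
  refine ⟨(I⁻¹ * I₁).toReal * (√((2 * Real.pi) ^ k))⁻¹ ^ N,
    mul_pos (ENNReal.toReal_pos hq0 hq) hg, fun M Z => ?_⟩
  have hC' := posDef_mul_transpose_add (Z - M) hC
  have h : ∀ P : Matrix (Fin k) (Fin k) ℝ, P.PosDef →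
      gaussianColumnsDensity M P Z * invWishartDensity C ν P =
      (I⁻¹ * ENNReal.ofReal ((√((2 * Real.pi) ^ k))⁻¹ ^ N)) *
        invWishartKernel ((Z - M) * (Z - M).transpose + C) (ν + N) P := fun P hP => by
    rw [invWishartDensity, ENNReal.div_eq_inv_mul, mul_left_comm,
      gaussianColumnsDensity_mul_invWishartKernel M Z C ν hP, mul_assoc]
  rw [columnsMarginal, integralPosDef_congr h,
    integralPosDef_const_mul (ENNReal.mul_ne_top (ENNReal.inv_ne_top.2 hI0) ENNReal.ofReal_ne_top),
    integralPosDef_invWishartKernel hC', mul_assoc, ENNReal.ofReal_mul (by positivity),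
    ENNReal.ofReal_mul ENNReal.toReal_nonneg, ENNReal.ofReal_toReal hq]
  ring

lemma measurable_gaussianColumnsDensity (M : Matrix (Fin k) (Fin N) ℝ) :
    Measurable fun x : (Fin k → Fin N → ℝ) × (SymIdx k → ℝ) =>
      gaussianColumnsDensity M (symMatrix x.2) (Matrix.of x.1) := by
  have hinv : ∀ i j, Measurable fun x : (Fin k → Fin N → ℝ) × (SymIdx k → ℝ) =>
      (symMatrix x.2)⁻¹ i j := fun i j => (measurable_symMatrix_inv_apply i j).comp measurable_snd
  have hdet : Measurable fun x : (Fin k → Fin N → ℝ) × (SymIdx k → ℝ) => (symMatrix x.2).det :=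
    continuous_symMatrix.matrix_det.measurable.comp measurable_snd
  have hdiff : ∀ i t, Measurable fun x : (Fin k → Fin N → ℝ) × (SymIdx k → ℝ) =>
      x.1 i t - M i t := fun i t => by fun_prop
  refine ENNReal.measurable_ofReal.comp (Finset.measurable_fun_prod _ fun t _ => ?_)
  refine Measurable.mul (hdet.const_mul _).sqrt.inv
    (Real.measurable_exp.comp (Measurable.const_mul ?_ _))
  simp only [dotProduct, Matrix.mulVec, Pi.sub_apply, Matrix.of_apply]
  exact Finset.measurable_fun_sum _ fun i _ => (hdiff i t).mul
    (Finset.measurable_fun_sum _ fun j _ => (hinv i j).mul (hdiff j t))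

lemma integralMatrix_columnsMarginal (M : Matrix (Fin k) (Fin N) ℝ)
    {C : Matrix (Fin k) (Fin k) ℝ} (hC : C.PosDef) {ν : ℝ} (hν : (k : ℝ) - 1 < ν) :
    integralMatrix (columnsMarginal M C ν) = 1 := by
  have hm : Measurable fun v => invWishartDensity C ν (symMatrix v) :=
    (measurable_invWishartKernel C ν).div_const _
  have hswap := lintegral_lintegral_swap (μ := (volume : Measure (Fin k → Fin N → ℝ)))
    (ν := (volume : Measure (SymIdx k → ℝ)).restrict (posDefCone k))
    (f := fun X v => gaussianColumnsDensity M (symMatrix v) (Matrix.of X) *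
      invWishartDensity C ν (symMatrix v))
    ((measurable_gaussianColumnsDensity M).mul (hm.comp measurable_snd)).aemeasurable
  refine hswap.trans ?_
  rw [← integralPosDef_invWishartDensity hC hν]
  refine integralPosDef_congr (f := fun P => ∫⁻ X : Fin k → Fin N → ℝ,
    gaussianColumnsDensity M P (Matrix.of X) * invWishartDensity C ν P) fun P hP => ?_
  rw [lintegral_mul_const' _ _ (invWishartDensity_ne_top C ν P)]
  exact (congrArg (· * _) (lintegral_gaussianColumnsDensity M hP)).trans (one_mul _)

lemma columnsMarginal_pos_and_lt_top {C : Matrix (Fin k) (Fin k) ℝ} (hC : C.PosDef) {ν : ℝ}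
    (hν : (k : ℝ) - 1 < ν) (M Z : Matrix (Fin k) (Fin N) ℝ) :
    0 < columnsMarginal M C ν Z ∧ columnsMarginal M C ν Z < ∞ := by
  obtain ⟨c, hc, h⟩ := exists_columnsMarginal_eq (N := N) hC hν
  rw [h]
  exact ⟨ENNReal.ofReal_pos.2 (mul_pos hc (Real.rpow_pos_of_pos
    (posDef_mul_transpose_add (Z - M) hC).det_pos _)), ENNReal.ofReal_lt_top⟩

/-- The determinant of `C + (Z - M)(Z - M)ᵀ` is at least `det C`, and its exponent is nonpositive.
-/
lemma exists_columnsMarginal_le {C : Matrix (Fin k) (Fin k) ℝ} (hC : C.PosDef) {ν : ℝ}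
    (hν : (k : ℝ) - 1 < ν) (hν0 : 0 ≤ ν + N) :
    ∃ B : ℝ≥0∞, B ≠ ∞ ∧ ∀ M Z : Matrix (Fin k) (Fin N) ℝ, columnsMarginal M C ν Z ≤ B := by
  obtain ⟨c, hc, h⟩ := exists_columnsMarginal_eq (N := N) hC hν
  refine ⟨ENNReal.ofReal (c * C.det ^ (-(ν + N) / 2)), ENNReal.ofReal_ne_top, fun M Z => ?_⟩
  rw [h]
  refine ENNReal.ofReal_le_ofReal (mul_le_mul_of_nonneg_left ?_ hc.le)
  refine Real.rpow_le_rpow_of_nonpos hC.det_pos ?_ (by linarith)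
  rw [det_mul_transpose_add _ hC]
  exact le_mul_of_one_le_right hC.det_pos.le (one_le_det_one_add _ hC)

lemma measurable_columnsMarginal {C : Matrix (Fin k) (Fin k) ℝ} (hC : C.PosDef) {ν : ℝ}
    (hν : (k : ℝ) - 1 < ν) {E : Type*} [TopologicalSpace E] [MeasurableSpace E]
    [OpensMeasurableSpace E] {f g : E → Matrix (Fin k) (Fin N) ℝ} (hf : Continuous f)
    (hg : Continuous g) : Measurable fun x => columnsMarginal (f x) C ν (g x) := by
  obtain ⟨c, -, h⟩ := exists_columnsMarginal_eq (N := N) hC hν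
  simp only [h]
  have hdet : Measurable fun x => ((g x - f x) * (g x - f x).transpose + C).det :=
    Continuous.measurable (by fun_prop)
  fun_prop

end Marginal

/-! ### Densities of the model and the cost function -/

namespace Model

variable {n m N : ℕ} (M : Model n m N)

lemma pXYPR_eq (X : Matrix (Fin n) (Fin N) ℝ) (Y : Matrix (Fin m) (Fin N) ℝ)
    (P : Matrix (Fin n) (Fin n) ℝ) (R : Matrix (Fin m) (Fin m) ℝ) :
    M.pXYPR X Y P R = (M.pXgivenP X P * M.pP P) *
      (gaussianColumnsDensity (M.H * X) R Y * invWishartDensity M.Cw M.νw R) := by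
  rw [pXYPR, pYgivenXR, gaussianColumnsDensity_zero_sub, pR]
  ring

lemma pXY_eq (hCw : M.Cw.PosDef) (hνw : (m : ℝ) - 1 < M.νw) (X : Matrix (Fin n) (Fin N) ℝ)
    (Y : Matrix (Fin m) (Fin N) ℝ) :
    M.pXY X Y = columnsMarginal (M.H * X) M.Cw M.νw Y * columnsMarginal M.U M.Cx M.νx X := by
  have h : ∀ P, (integralPosDef fun R => M.pXYPR X Y P R) =
      columnsMarginal (M.H * X) M.Cw M.νw Y * (M.pXgivenP X P * M.pP P) := fun P => by
    simp only [pXYPR_eq]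
    rw [integralPosDef_const_mul, mul_comm]
    · rfl
    · exact ENNReal.mul_ne_top ENNReal.ofReal_ne_top (invWishartDensity_ne_top _ _ _)
  rw [pXY]
  simp only [h]
  rw [integralPosDef_const_mul (columnsMarginal_pos_and_lt_top hCw hνw _ _).2.ne]
  rfl

lemma pX_eq (hCx : M.Cx.PosDef) (hνx : (n : ℝ) - 1 < M.νx) (hCw : M.Cw.PosDef)
    (hνw : (m : ℝ) - 1 < M.νw) (X : Matrix (Fin n) (Fin N) ℝ) :
    M.pX X = columnsMarginal M.U M.Cx M.νx X := by
  simp only [pX, integralMatrix, M.pXY_eq hCw hνw]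
  rw [lintegral_mul_const' _ _ (columnsMarginal_pos_and_lt_top hCx hνx _ _).2.ne]
  exact (congrArg (· * _) (integralMatrix_columnsMarginal _ hCw hνw)).trans (one_mul _)

lemma pYgivenX_eq (hCx : M.Cx.PosDef) (hνx : (n : ℝ) - 1 < M.νx) (hCw : M.Cw.PosDef)
    (hνw : (m : ℝ) - 1 < M.νw) (X : Matrix (Fin n) (Fin N) ℝ) (Y : Matrix (Fin m) (Fin N) ℝ) :
    M.pYgivenX Y X = columnsMarginal (M.H * X) M.Cw M.νw Y := by
  have hX := columnsMarginal_pos_and_lt_top hCx hνx M.U X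
  rw [pYgivenX, M.pX_eq hCx hνx hCw hνw, M.pXY_eq hCw hνw,
    ENNReal.mul_div_cancel_right hX.1.ne' hX.2.ne]

lemma pY_ne_zero_and_ne_top (hCx : M.Cx.PosDef) (hνx : (n : ℝ) - 1 < M.νx) (hCw : M.Cw.PosDef)
    (hνw : (m : ℝ) - 1 < M.νw) (hνw0 : 0 ≤ M.νw + N) (Y : Matrix (Fin m) (Fin N) ℝ) :
    M.pY Y ≠ 0 ∧ M.pY Y ≠ ∞ := by
  simp only [pY, integralMatrix, M.pXY_eq hCw hνw]
  constructor
  · have hof : Continuous fun X : Fin n → Fin N → ℝ => (Matrix.of X : Matrix (Fin n) (Fin N) ℝ) :=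
      continuous_id
    have hm := (measurable_columnsMarginal (N := N) hCw hνw (continuous_const.matrix_mul hof :
      Continuous fun X : Fin n → Fin N → ℝ => M.H * Matrix.of X) (continuous_const (y := Y))).mul
      (measurable_columnsMarginal hCx hνx (continuous_const (y := M.U)) hof)
    intro h0
    obtain ⟨X, hX⟩ := ((lintegral_eq_zero_iff hm).1 h0).exists
    exact mul_ne_zero (columnsMarginal_pos_and_lt_top hCw hνw (M.H * Matrix.of X) Y).1.ne'
      (columnsMarginal_pos_and_lt_top hCx hνx M.U (Matrix.of X)).1.ne' hX
  · obtain ⟨B, hB, hle⟩ := exists_columnsMarginal_le (N := N) hCw hνw hνw0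
    -- The likelihood is bounded uniformly in `X` and the prior has total mass one.
    refine (lt_of_le_of_lt (lintegral_mono fun X => mul_le_mul_left (hle _ _) _) ?_).ne
    rw [lintegral_const_mul' _ _ hB]
    refine ENNReal.mul_lt_top hB.lt_top ?_
    exact (integralMatrix_columnsMarginal M.U hCx hνx).trans_lt ENNReal.one_lt_top

lemma continuous_cost (hCx : M.Cx.PosDef) (hCw : M.Cw.PosDef) (γw γx : ℝ)
    (Y : Matrix (Fin m) (Fin N) ℝ) : Continuous (M.cost γw γx Y) := by
  unfold cost
  refine Continuous.add (continuous_const.mul (Continuous.log (by fun_prop) fun X => ?_))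
    (continuous_const.mul (Continuous.log (by fun_prop) fun X => ?_))
  · exact (one_pos.trans_le (one_le_det_one_add _ hCw)).ne'
  · exact (one_pos.trans_le (one_le_det_one_add _ hCx)).ne'

lemma exists_isMinOn_cost (hCx : M.Cx.PosDef) (hCw : M.Cw.PosDef) {γw γx : ℝ} (hγw : 0 ≤ γw)
    (hγx : 0 < γx) (Y : Matrix (Fin m) (Fin N) ℝ) :
    ∃ X, IsMinOn (M.cost γw γx Y) Set.univ X := by
  have htend : Filter.Tendsto (M.cost γw γx Y) (Filter.cocompact _) Filter.atTop := by
    -- The prior term alone is coercive; the likelihood term is nonnegative and can be dropped.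
    refine Filter.tendsto_atTop_mono (fun X => ?_) (Filter.Tendsto.const_mul_atTop
      (half_pos hγx) (Real.tendsto_log_atTop.comp (tendsto_det_one_add_cocompact M.U hCx)))
    exact le_add_of_nonneg_left (mul_nonneg (by linarith)
      (Real.log_nonneg (one_le_det_one_add _ hCw)))
  obtain ⟨X, hX⟩ := (M.continuous_cost hCx hCw γw γx Y).exists_forall_le htend
  exact ⟨X, fun Z _ => hX Z⟩

lemma exists_neg_log_eq_cost_add (hCx : M.Cx.PosDef) (hνx : (n : ℝ) - 1 < M.νx)
    (hCw : M.Cw.PosDef) (hνw : (m : ℝ) - 1 < M.νw) (hνw0 : 0 ≤ M.νw + N)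
    (Y : Matrix (Fin m) (Fin N) ℝ) :
    ∃ K : ℝ, ∀ X : Matrix (Fin n) (Fin N) ℝ, 0 < M.pXgivenY X Y ∧ M.pXgivenY X Y < ⊤ ∧
      -Real.log (M.pXgivenY X Y).toReal = M.cost (M.νw + N) (M.νx + N) Y X + K := by
  obtain ⟨hY0, hY⟩ := M.pY_ne_zero_and_ne_top hCx hνx hCw hνw hνw0 Y
  obtain ⟨cx, hcx, hx⟩ := exists_columnsMarginal_eq (N := N) hCx hνx
  obtain ⟨cw, hcw, hw⟩ := exists_columnsMarginal_eq (N := N) hCw hνw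
  refine ⟨(M.νw + N) / 2 * Real.log M.Cw.det + (M.νx + N) / 2 * Real.log M.Cx.det -
    Real.log cw - Real.log cx + Real.log (M.pY Y).toReal, fun X => ?_⟩
  have hX := columnsMarginal_pos_and_lt_top hCx hνx M.U X
  have hW := columnsMarginal_pos_and_lt_top hCw hνw (M.H * X) Y
  rw [pXgivenY, M.pXY_eq hCw hνw]
  refine ⟨ENNReal.div_pos (mul_ne_zero hW.1.ne' hX.1.ne') hY,
    ENNReal.div_lt_top (ENNReal.mul_lt_top hW.2 hX.2).ne hY0, ?_⟩
  have hdx := (posDef_mul_transpose_add (X - M.U) hCx).det_pos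
  have hdw := (posDef_mul_transpose_add (Y - M.H * X) hCw).det_pos
  have hlx : Real.log (columnsMarginal M.U M.Cx M.νx X).toReal = Real.log cx -
      (M.νx + N) / 2 * (Real.log M.Cx.det +
        Real.log (1 + (X - M.U).transpose * M.Cx⁻¹ * (X - M.U)).det) := by
    rw [hx, ENNReal.toReal_ofReal (by positivity), Real.log_mul hcx.ne' (by positivity),
      Real.log_rpow hdx, det_mul_transpose_add _ hCx, Real.log_mul hCx.det_pos.ne'
        (one_pos.trans_le (one_le_det_one_add _ hCx)).ne']
    ring
  have hlw : Real.log (columnsMarginal (M.H * X) M.Cw M.νw Y).toReal = Real.log cw -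
      (M.νw + N) / 2 * (Real.log M.Cw.det +
        Real.log (1 + (Y - M.H * X).transpose * M.Cw⁻¹ * (Y - M.H * X)).det) := by
    rw [hw, ENNReal.toReal_ofReal (by positivity), Real.log_mul hcw.ne' (by positivity),
      Real.log_rpow hdw, det_mul_transpose_add _ hCw, Real.log_mul hCw.det_pos.ne'
        (one_pos.trans_le (one_le_det_one_add _ hCw)).ne']
    ring
  have hX' := ENNReal.toReal_pos hX.1.ne' hX.2.ne
  have hW' := ENNReal.toReal_pos hW.1.ne' hW.2.ne
  have hY' := ENNReal.toReal_pos hY0 hY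
  rw [ENNReal.toReal_div, ENNReal.toReal_mul, Real.log_div (by positivity) hY'.ne',
    Real.log_mul hW'.ne' hX'.ne', hlx, hlw, cost]
  ring

end Model

end MMAP

/-! ### The main theorem -/

theorem mainTheorem5 {n m N : ℕ} (M : MMAP.Model n m N)
    (hCx : M.Cx.PosDef) (hCw : M.Cw.PosDef)
    (hνx : (n : ℝ) + 1 < M.νx) (hνw : (m : ℝ) + 1 < M.νw) :
    -- the marginal prior: `p(X) = ∫ p(X | P) p(P) dP ∝ |X̃ X̃ᵀ + Cx|^{-(νx+N)/2}`
    (∃ c : ℝ, 0 < c ∧ ∀ X : Matrix (Fin n) (Fin N) ℝ,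
      M.pX X = MMAP.integralPosDef (fun P => M.pXgivenP X P * M.pP P) ∧
      M.pX X = ENNReal.ofReal
        (c * ((X - M.U) * (X - M.U).transpose + M.Cx).det ^ (-(M.νx + N) / 2))) ∧
    -- the marginal likelihood: `p(Y | X) = ∫ p(Y | X, R) p(R) dR ∝ |Ỹ Ỹᵀ + Cw|^{-(νw+N)/2}`
    (∃ c : ℝ, 0 < c ∧ ∀ (X : Matrix (Fin n) (Fin N) ℝ) (Y : Matrix (Fin m) (Fin N) ℝ),
      M.pYgivenX Y X = MMAP.integralPosDef (fun R => M.pYgivenXR Y X R * M.pR R) ∧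
      M.pYgivenX Y X = ENNReal.ofReal
        (c * ((Y - M.H * X) * (Y - M.H * X).transpose + M.Cw).det ^ (-(M.νw + N) / 2))) ∧
    -- the posterior and the marginalized MAP estimator
    (∀ Y : Matrix (Fin m) (Fin N) ℝ,
      (∃ k : ℝ, 0 < k ∧ ∀ X : Matrix (Fin n) (Fin N) ℝ,
        M.pXgivenY X Y = ENNReal.ofReal k * (M.pYgivenX Y X * M.pX X)) ∧
      (∃ K : ℝ, ∀ X : Matrix (Fin n) (Fin N) ℝ,
        0 < M.pXgivenY X Y ∧ M.pXgivenY X Y < ⊤ ∧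
        -Real.log (M.pXgivenY X Y).toReal = M.cost (M.νw + N) (M.νx + N) Y X + K) ∧
      (∃ Xhat : Matrix (Fin n) (Fin N) ℝ, M.IsMarginalizedMAP Y Xhat) ∧
      (∀ Xhat : Matrix (Fin n) (Fin N) ℝ, M.IsMarginalizedMAP Y Xhat ↔
        IsMinOn (M.cost (M.νw + N) (M.νx + N) Y) Set.univ Xhat)) := by
  have hνx' : (n : ℝ) - 1 < M.νx := by linarith
  have hνw' : (m : ℝ) - 1 < M.νw := by linarith
  have hn : (0 : ℝ) ≤ n := n.cast_nonneg
  have hm : (0 : ℝ) ≤ m := m.cast_nonneg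
  have hN : (0 : ℝ) ≤ N := N.cast_nonneg
  have hγx : 0 < M.νx + N := by linarith
  have hγw : 0 < M.νw + N := by linarith
  have hX := M.pX_eq hCx hνx' hCw hνw'
  have hYX := M.pYgivenX_eq hCx hνx' hCw hνw'
  refine ⟨?_, ?_, fun Y => ?_⟩
  · obtain ⟨c, hc, h⟩ := MMAP.exists_columnsMarginal_eq (N := N) hCx hνx'
    exact ⟨c, hc, fun X => ⟨hX X, (hX X).trans (h _ _)⟩⟩
  · obtain ⟨c, hc, h⟩ := MMAP.exists_columnsMarginal_eq (N := N) hCw hνw'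
    refine ⟨c, hc, fun X Y => ⟨?_, (hYX X Y).trans (h _ _)⟩⟩
    simp only [MMAP.Model.pYgivenXR, MMAP.gaussianColumnsDensity_zero_sub]
    exact hYX X Y
  · obtain ⟨hY0, hY⟩ := M.pY_ne_zero_and_ne_top hCx hνx' hCw hνw' hγw.le Y
    obtain ⟨K, hK⟩ := M.exists_neg_log_eq_cost_add hCx hνx' hCw hνw' hγw.le Y
    have hiff : ∀ Xhat : Matrix (Fin n) (Fin N) ℝ, M.IsMarginalizedMAP Y Xhat ↔
        IsMinOn (M.cost (M.νw + N) (M.νx + N) Y) Set.univ Xhat := by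
      -- Both costs carry the same `K`, so monotonicity of the logarithm reverses the order exactly.
      have hle : ∀ X X' : Matrix (Fin n) (Fin N) ℝ, M.pXgivenY X Y ≤ M.pXgivenY X' Y ↔
          M.cost (M.νw + N) (M.νx + N) Y X' ≤ M.cost (M.νw + N) (M.νx + N) Y X := by
        intro X X'
        obtain ⟨h1, h2, h3⟩ := hK X
        obtain ⟨h1', h2', h3'⟩ := hK X'
        rw [← ENNReal.toReal_le_toReal h2.ne h2'.ne, ← Real.log_le_log_iff
          (ENNReal.toReal_pos h1.ne' h2.ne) (ENNReal.toReal_pos h1'.ne' h2'.ne)]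
        constructor <;> intro h <;> linarith
      intro Xhat
      simp only [MMAP.Model.IsMarginalizedMAP, isMaxOn_iff, isMinOn_iff, hle]
    refine ⟨⟨(M.pY Y)⁻¹.toReal, ENNReal.toReal_pos (ENNReal.inv_ne_zero.2 hY)
      (ENNReal.inv_ne_top.2 hY0), fun X => ?_⟩, ⟨K, hK⟩, ?_, hiff⟩
    · rw [ENNReal.ofReal_toReal (ENNReal.inv_ne_top.2 hY0), hX, hYX, MMAP.Model.pXgivenY,
        M.pXY_eq hCw hνw', ENNReal.div_eq_inv_mul]
    · obtain ⟨X, h⟩ := M.exists_isMinOn_cost hCx hCw hγw.le hγx Y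
      exact ⟨X, (hiff X).2 h⟩
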